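/- **Notation.** Let $\preceq$ be the Loewner order, $\|\cdot\|_F$ the Frobenius norm, $\Pi_V$ the orthogonal projection onto a subspace $V\subseteq\mathbb R^d$. A randomized algorithm $M$ on datasets of size $n$ is $\rho$-zCDP if $D_\alpha(M(X)\|M(X'))\le\rho\alpha$ for all $\alpha\in(1,\infty)$ and all datasets $X,X'$ differing in at most one entry, where $D_\alpha(P\|Q)=\frac1{\alpha-1}\log\int (dP/dQ)^\alpha\,dQ$ if $P\ll Q$ and $D_\alpha(P\|Q)=+\infty$ otherwise. **Algorithm.** Let $\rho,\beta,\kappa,K>0$ and let $c_S,c_N>0$ be constants. $\mathrm{NaivePCE}$, on input $X=(X_1,\dots,X_n)\in(\mathbb R^d)^n$, returns the Frobenius-projection onto the PSD cone of $\frac1n\sum_{i:\|X_i\|^2\le\tau}X_iX_i^\top+N$, where $\tau=c_S\,d\kappa\log(n/\beta)$ and $N$ is a random symmetric matrix with entries $N_{ij}$ ($i\le j$) i.i.d. $\mathcal N(0,\sigma^2)$, $\sigma=c_N\frac{d\kappa\log(n/\beta)}{n\rho^{1/2}}$. $\mathrm{WeakPPC}_{\rho,\beta,\kappa,K}(X)$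 runs $\mathrm{NaivePCE}$ to get $Z$ and outputs $(V,A)$, where $V$ is the span of the eigenvectors of $Z$ with eigenvalue at least $\kappa/2$ and $A=K^{-1/2}\Pi_V+\Pi_{V^\perp}$. **Regularity.** For $\Sigma\succ0$ put $Y_i=\Sigma^{-1/2}X_i$ and $\hat\Sigma_Y=\frac1n\sum_iY_iY_i^\top$. The dataset $X$ is regular (with constants $c_1,c_2,c_3>0$) if $\|Y_i\|^2\le c_1d\log(n/\beta)$ for all $i$, $\big(1-c_2\sqrt{\tfrac{d+\log(1/\beta)}n}\big)I\preceq\hat\Sigma_Y\preceq\big(1+c_2\sqrt{\tfrac{d+\log(1/\beta)}n}\big)I$, and $\|I-\hat\Sigma_Y\|_F\le c_3\sqrt{\tfrac{d^2+\log(1/\beta)}n}$. **Theorem (WeakPPC).** 1. *(Privacy.)* If $c_S>0$ and $c_N\ge\sqrt2\,c_S$, then for all $d,n$ and all $\rho,\beta,\kappa,K>0$, $\mathrm{WeakPPC}_{\rho,\beta,\kappa,K}$ is $\rho$-zCDP. 2. *(Accuracy.)* There are absolute constants $K_0>0$ and $p\in\mathbb N$ such that for all $c_1,c_2,c_3>0$,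 $c_S\ge c_1$ and $c_N\ge\sqrt2\,c_S$ there are constants $C_\varphi,C_\psi,C_\beta,C_n>0$, depending only on $c_1,c_2,c_3,c_S,c_N$, such that the following holds for all $d$, all $n\ge1$, all $\rho,\beta,\kappa,K>0$ and all $\Sigma\in\mathbb R^{d\times d}$ with $I\preceq\Sigma\preceq\kappa I$. Let $$\varphi=C_\varphi\frac{d^{3/2}\log(n/\beta)\log(1/\beta)}{n\rho^{1/2}},\quad \psi=C_\psi\sqrt{\frac{d+\log(1/\beta)}n},\quad \Gamma=\max\Big\{\frac{2K}{(\frac12-\varphi)\kappa},\frac{16K\varphi^2}{(\frac12-\varphi)^2}\Big\}.$$ For every regular dataset $X$, with probability at least $1-C_\beta\beta$ over the randomness of the algorithm, the output $(V,A)$ satisfies simultaneously: - $A\Sigma A\preceq(1+\psi)\,\kappa\,\big(\max(\tfrac1K,\tfrac12)+\varphi\big)I$; - if $\psi\le1$ and $\varphi\ne\frac12$, then $(1-\psi)^2(1-\Gamma)I\preceq A\Sigma A$; - if $\kappa>1000$, $K=K_0$ and $n\ge C_n\,d^{3/2}\log^p\!\big(2+\tfrac d{\min(\rho,1)\beta}\big)/\rho^{1/2}$,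 and if moreover $n\ge C_n(d+\log(1/\beta))$ in case $\rho>1$, then $I\preceq(1.1A)\Sigma(1.1A)\preceq\frac7{10}\kappa I$. Consequently, if $X_1,\dots,X_n$ are i.i.d. $\mathcal N(0,\Sigma)$, then the probability that $X$ is regular and the output satisfies these three properties is at least $(1-C_\beta\beta)\Pr[X\text{ is regular}]$. -/

import Mathlib

open MeasureTheory ProbabilityTheory
open scoped ENNReal NNReal MatrixOrder

/- Throughout, `A ≤ B` for real square matrices is the Loewner order of Mathlib
(scope `MatrixOrder`): `B - A` is symmetric positive semidefinite. -/

namespace PrivCov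

noncomputable section

/-! ### Measurable structure on the output space -/

/-- The Borel σ-algebra on matrices, i.e. the product σ-algebra of the entries. -/
instance instMeasurableSpaceMatrix (d : ℕ) : MeasurableSpace (Matrix (Fin d) (Fin d) ℝ) :=
  inferInstanceAs (MeasurableSpace (Fin d → Fin d → ℝ))

/-- The matrix `Π_V` of the orthogonal projection onto the subspace `V` of `ℝ^d`. -/
def projMatrix {d : ℕ} (V : Submodule ℝ (EuclideanSpace ℝ (Fin d))) : Matrix (Fin d) (Fin d) ℝ :=
  (Matrix.toEuclideanCLM (n := Fin d) (𝕜 := ℝ)).symm V.starProjection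

/-- The Borel σ-algebra on the set of subspaces of `ℝ^d` (the union of the Grassmannians):
subspaces are identified with their orthogonal projections. -/
instance instMeasurableSpaceSubspace (d : ℕ) :
    MeasurableSpace (Submodule ℝ (EuclideanSpace ℝ (Fin d))) :=
  MeasurableSpace.comap projMatrix inferInstance

/-! ### Zero-concentrated differential privacy -/

/-- Rényi divergence of order `α` of `P` from `Q`, with values in the extended reals:
`(α - 1)⁻¹ log ∫ (dP/dQ)^α dQ` if `P ≪ Q`, and `+∞` otherwise. -/
def renyiDiv {Y : Type*} [MeasurableSpace Y] (α : ℝ) (P Q : Measure Y) : EReal :=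
  open Classical in
  if P ≪ Q then (((α - 1)⁻¹ : ℝ) : EReal) * ENNReal.log (∫⁻ y, (P.rnDeriv Q y) ^ α ∂Q) else ⊤

/-- Two datasets are neighboring if they differ on at most a single entry. -/
def Neighboring {𝒳 : Type*} {n : ℕ} (X X' : Fin n → 𝒳) : Prop :=
  {i | X i ≠ X' i}.Subsingleton

/-- `ρ`-zCDP. A randomized algorithm is a map from datasets to probability measures. -/
def IsZCDP {𝒳 Y : Type*} [MeasurableSpace Y] {n : ℕ} (ρ : ℝ)
    (M : (Fin n → 𝒳) → Measure Y) : Prop :=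
  (∀ X, IsProbabilityMeasure (M X)) ∧
    ∀ X X', Neighboring X X' → ∀ α : ℝ, 1 < α → renyiDiv α (M X) (M X') ≤ ((ρ * α : ℝ) : EReal)

/-! ### The Frobenius norm and the projection onto the cone of PSD matrices -/

/-- The Frobenius norm. -/
def frob {d : ℕ} (M : Matrix (Fin d) (Fin d) ℝ) : ℝ := √(∑ i, ∑ j, M i j ^ 2)

section PSD

attribute [local instance] Matrix.frobeniusNormedAddCommGroup Matrix.frobeniusNormedSpace

theorem frob_eq_norm {d : ℕ} (M : Matrix (Fin d) (Fin d) ℝ) : frob M = ‖M‖ := by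
  rw [Matrix.frobenius_norm_def, frob, Real.sqrt_eq_rpow]
  simp

/-- Every matrix has a Frobenius-nearest positive semidefinite matrix. -/
theorem exists_nearest_psd {d : ℕ} (M : Matrix (Fin d) (Fin d) ℝ) :
    ∃ P : Matrix (Fin d) (Fin d) ℝ, P.PosSemidef ∧
      ∀ Q : Matrix (Fin d) (Fin d) ℝ, Q.PosSemidef → frob (M - P) ≤ frob (M - Q) := by
  have hc : IsClosed {P : Matrix (Fin d) (Fin d) ℝ | P.PosSemidef} := by
    have : {P : Matrix (Fin d) (Fin d) ℝ | P.PosSemidef} =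
        {P | P.conjTranspose = P} ∩ ⋂ x : Fin d → ℝ, {P | 0 ≤ star x ⬝ᵥ (P.mulVec x)} := by
      ext P
      simp only [Set.mem_ofPred_eq, Set.mem_inter_iff, Set.mem_iInter]
      exact Matrix.posSemidef_iff_dotProduct_mulVec
    rw [this]
    refine IsClosed.inter (isClosed_eq ?_ continuous_id) (isClosed_iInter fun x => ?_)
    · exact Continuous.matrix_conjTranspose continuous_id
    · refine isClosed_le continuous_const ?_
      exact Continuous.dotProduct continuous_const (Continuous.matrix_mulVec continuous_id
        continuous_const)
  have : ProperSpace (Matrix (Fin d) (Fin d) ℝ) := FiniteDimensional.proper ℝ _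
  obtain ⟨P, hP, h⟩ := hc.exists_infDist_eq_dist ⟨0, Matrix.PosSemidef.zero⟩ M
  refine ⟨P, hP, fun Q hQ => ?_⟩
  rw [frob_eq_norm, frob_eq_norm, ← dist_eq_norm, ← dist_eq_norm, ← h]
  exact Metric.infDist_le_dist_of_mem hQ

end PSD

/-- The projection of `M` onto the set of positive semidefinite matrices: the
(unique) nearest positive semidefinite matrix in Frobenius norm. -/
def psdProj {d : ℕ} (M : Matrix (Fin d) (Fin d) ℝ) : Matrix (Fin d) (Fin d) ℝ :=
  (exists_nearest_psd M).choose

/-! ### The algorithms -/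

/-- `GUE(v)`: the law of a random symmetric `d × d` matrix whose entries `M i j`, `i ≤ j`, are
i.i.d. `N(0, v)`. The independent entries are indexed by unordered pairs of indices. -/
def gue (d : ℕ) (v : ℝ≥0) : Measure (Matrix (Fin d) (Fin d) ℝ) :=
  (Measure.pi fun _ : Sym2 (Fin d) => gaussianReal 0 v).map fun g => Matrix.of fun i j => g s(i, j)

/-- The empirical covariance `(1/n) ∑ Xᵢ Xᵢᵀ`. -/
def empCov {d n : ℕ} (X : Fin n → EuclideanSpace ℝ (Fin d)) : Matrix (Fin d) (Fin d) ℝ :=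
  (n : ℝ)⁻¹ • ∑ i, Matrix.vecMulVec (X i).ofLp (X i).ofLp

/-- The truncated empirical covariance `(1/n) ∑_{i : ‖Xᵢ‖² ≤ τ} Xᵢ Xᵢᵀ`. -/
def truncCov {d n : ℕ} (τ : ℝ) (X : Fin n → EuclideanSpace ℝ (Fin d)) :
    Matrix (Fin d) (Fin d) ℝ :=
  open Classical in
  (n : ℝ)⁻¹ • ∑ i with ‖X i‖ ^ 2 ≤ τ, Matrix.vecMulVec (X i).ofLp (X i).ofLp

/-- Squared norm threshold `cS · d κ log(n/β)` for keeping a sample. -/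
def threshold (cS : ℝ) (d n : ℕ) (β κ : ℝ) : ℝ := cS * (d * κ * Real.log (n / β))

/-- Standard deviation `cN · d κ log(n/β) / (n ρ^{1/2})` of the added noise. -/
def noiseScale (cN : ℝ) (d n : ℕ) (ρ β κ : ℝ) : ℝ :=
  cN * (d * κ * Real.log (n / β) / (n * √ρ))

/-- The output law of `NaivePCE` on the dataset `X`: discard the samples of large norm, add
`GUE(σ²)` noise to the truncated empirical covariance, project onto the PSD cone. The numbers
`cS`, `cN` are the constants in the threshold and in the noise level. -/
def naivePCE (cS cN ρ β κ : ℝ) {d n : ℕ} (X : Fin n → EuclideanSpace ℝ (Fin d)) :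
    Measure (Matrix (Fin d) (Fin d) ℝ) :=
  (gue d (noiseScale cN d n ρ β κ ^ 2).toNNReal).map fun N =>
    psdProj (truncCov (threshold cS d n β κ) X + N)

/-- The span of the eigenvectors of `Z` with eigenvalue at least `κ / 2`. -/
def topSpace {d : ℕ} (κ : ℝ) (Z : Matrix (Fin d) (Fin d) ℝ) :
    Submodule ℝ (EuclideanSpace ℝ (Fin d)) :=
  Submodule.span ℝ {v | ∃ μ : ℝ, κ / 2 ≤ μ ∧
    Module.End.HasEigenvector (Matrix.toEuclideanLin Z) μ v}

/-- `A = K^{-1/2} Π_V + Π_{V^⊥}`. -/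
def precond {d : ℕ} (K : ℝ) (V : Submodule ℝ (EuclideanSpace ℝ (Fin d))) :
    Matrix (Fin d) (Fin d) ℝ :=
  (1 / √K) • projMatrix V + projMatrix Vᗮ

/-- The output law of `WeakPPC` on the dataset `X`: run `NaivePCE` to get `Z`, and return `(V, A)`
where `V` is spanned by the eigenvectors of `Z` with eigenvalue at least `κ / 2` and
`A = K^{-1/2} Π_V + Π_{V^⊥}`. -/
def weakPPC (cS cN ρ β κ K : ℝ) {d n : ℕ} (X : Fin n → EuclideanSpace ℝ (Fin d)) :
    Measure (Submodule ℝ (EuclideanSpace ℝ (Fin d)) × Matrix (Fin d) (Fin d) ℝ) :=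
  (naivePCE cS cN ρ β κ X).map fun Z => (topSpace κ Z, precond K (topSpace κ Z))

/-! ### Regularity conditions and error terms -/

/-- The whitened samples `Yᵢ = S^{-1/2} Xᵢ`. -/
def whiten {d n : ℕ} (S : Matrix (Fin d) (Fin d) ℝ) (X : Fin n → EuclideanSpace ℝ (Fin d)) :
    Fin n → EuclideanSpace ℝ (Fin d) :=
  fun i => WithLp.toLp 2 ((CFC.sqrt S)⁻¹.mulVec (X i).ofLp)

/-- The deterministic regularity conditions on samples `Xᵢ` from `N(0, S)`, with constants
`c₁, c₂, c₃`, stated for the whitened samples. -/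
structure Regular (c₁ c₂ c₃ β : ℝ) {d n : ℕ} (S : Matrix (Fin d) (Fin d) ℝ)
    (X : Fin n → EuclideanSpace ℝ (Fin d)) : Prop where
  norm_sq_le : ∀ i, ‖whiten S X i‖ ^ 2 ≤ c₁ * (d * Real.log (n / β))
  le_empCov : (1 - c₂ * √((d + Real.log (1 / β)) / n)) • 1 ≤ empCov (whiten S X)
  empCov_le : empCov (whiten S X) ≤ (1 + c₂ * √((d + Real.log (1 / β)) / n)) • 1
  frob_le : frob (1 - empCov (whiten S X)) ≤ c₃ * √(((d : ℝ) ^ 2 + Real.log (1 / β)) / n)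

/-- `φ = C d^{3/2} log(n/β) log(1/β) / (n ρ^{1/2})`. -/
def phi (C : ℝ) (d n : ℕ) (ρ β : ℝ) : ℝ :=
  C * ((d : ℝ) ^ (3 / 2 : ℝ) * Real.log (n / β) * Real.log (1 / β) / (n * √ρ))

/-- `ψ = C √((d + log(1/β)) / n)`. -/
def psi (C : ℝ) (d n : ℕ) (β : ℝ) : ℝ := C * √((d + Real.log (1 / β)) / n)

/-- `Γ = max {2K / ((1/2 - φ) κ), 16 K φ² / (1/2 - φ)²}`. -/
def Gam (φ κ K : ℝ) : ℝ :=
  max (2 * K / ((1 / 2 - φ) * κ)) (16 * K * φ ^ 2 / (1 / 2 - φ) ^ 2)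

/-- The sample size requirement `n ≥ C d^{3/2} log^p(2 + d/(ρβ)) / ρ^{1/2}` for `ρ ≤ 1`. For
`ρ > 1` the `ρ` inside the logarithm is replaced by `1`, and moreover `n ≥ C (d + log(1/β))`
(which for `ρ ≤ 1` follows from the first bound up to a constant). -/
def EnoughSamples (C : ℝ) (p d n : ℕ) (ρ β : ℝ) : Prop :=
  C * ((d : ℝ) ^ (3 / 2 : ℝ) * Real.log (2 + d / (min ρ 1 * β)) ^ p / √ρ) ≤ n ∧
    (1 < ρ → C * (d + Real.log (1 / β)) ≤ n)

end

end PrivCov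

open PrivCov

/-! Privacy. Changing one sample moves the truncated covariance by at most `√2 |τ| / n` in Frobenius
norm, since two rank-one terms `xxᵀ`, `yyᵀ` have nonnegative inner product. Adding symmetric
Gaussian noise is therefore a Gaussian mechanism on the entries indexed by unordered pairs. Its
Rényi divergence is explicit (`renyiDiv_pi_gaussianReal_le`), and everything after the noise is
post-processing (`renyiDiv_map_le`). The delicate point is that the spectral subspace depends
measurably on the matrix; its projection is obtained as a limit of rational functions.

Accuracy. A regular dataset loses no sample to truncation, its empirical covariance `E` lies within
factors `1 ± p` of `S`, and a net argument bounds the noise `N` by `κφ/2` in operator norm.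
Projecting `E + N` onto the PSD cone does not change eigenvectors with positive eigenvalue
(`topSpace_psdProj`), so what remains is a deterministic statement about `NoisyCov`.

Let `V` be the top space of `E + N`, `x = a + b` with `a ∈ V`, `b ∈ Vᗮ`, and `w = A x = K^{-1/2} a +
b`. Both spaces are invariant under `E + N`, so its form has no cross term. For the upper bound
(`NoisyCov.quad_le`), directions in `V` are damped by `1/K`, and on `Vᗮ` the noisy form is at most
`κ/2`. For the lower bound (`NoisyCov.le_quad`), if `a` is small compared with `b` then `S ≥ 1`
suffices; otherwise the form of `E` on `V`, at least about `κ/2`, pays both for the damping and for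
the cross term, which consists of noise only. `Γ` is the ratio at which the two cases meet. Taking
`K = 2` with small `φ` and `ψ`, a rescaling by `1.1` gives the improved condition number. -/

namespace PrivCov

/-! ### The projection onto the PSD cone -/

section Projection

variable {d : ℕ}

/-- The trace inner product of real matrices. -/
def frobInner (A B : Matrix (Fin d) (Fin d) ℝ) : ℝ := ∑ i, ∑ j, A i j * B i j

theorem frob_sq (A : Matrix (Fin d) (Fin d) ℝ) : frob A ^ 2 = frobInner A A := by
  rw [frob, Real.sq_sqrt (by positivity)]
  simp [frobInner, sq]

theorem frob_nonneg (A : Matrix (Fin d) (Fin d) ℝ) : 0 ≤ frob A := Real.sqrt_nonneg _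

theorem frobInner_add_left (A B C : Matrix (Fin d) (Fin d) ℝ) :
    frobInner (A + B) C = frobInner A C + frobInner B C := by
  simp [frobInner, add_mul, Finset.sum_add_distrib]

theorem frobInner_sub_left (A B C : Matrix (Fin d) (Fin d) ℝ) :
    frobInner (A - B) C = frobInner A C - frobInner B C := by
  simp [frobInner, sub_mul, Finset.sum_sub_distrib]

theorem frobInner_smul_left (a : ℝ) (A B : Matrix (Fin d) (Fin d) ℝ) :
    frobInner (a • A) B = a * frobInner A B := by
  simp [frobInner, Finset.mul_sum, mul_assoc]

theorem frobInner_comm (A B : Matrix (Fin d) (Fin d) ℝ) : frobInner A B = frobInner B A := by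
  simp [frobInner, mul_comm]

theorem frobInner_add_right (A B C : Matrix (Fin d) (Fin d) ℝ) :
    frobInner A (B + C) = frobInner A B + frobInner A C := by
  simp only [frobInner_comm A, frobInner_add_left]

theorem frobInner_sub_right (A B C : Matrix (Fin d) (Fin d) ℝ) :
    frobInner A (B - C) = frobInner A B - frobInner A C := by
  simp only [frobInner_comm A, frobInner_sub_left]

theorem frobInner_smul_right (a : ℝ) (A B : Matrix (Fin d) (Fin d) ℝ) :
    frobInner A (a • B) = a * frobInner A B := by
  simp only [frobInner_comm A, frobInner_smul_left]

theorem frobInner_le_frob_mul_frob (A B : Matrix (Fin d) (Fin d) ℝ) :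
    frobInner A B ≤ frob A * frob B := by
  have := Real.sum_mul_le_sqrt_mul_sqrt (Finset.univ : Finset (Fin d × Fin d))
    (fun p => A p.1 p.2) (fun p => B p.1 p.2)
  simpa only [frobInner, frob, Fintype.sum_prod_type] using this

theorem frobInner_vecMulVec (A : Matrix (Fin d) (Fin d) ℝ) (x : Fin d → ℝ) :
    frobInner A (Matrix.vecMulVec x x) = x ⬝ᵥ A.mulVec x := by
  simp only [frobInner, Matrix.vecMulVec_apply, dotProduct, Matrix.mulVec, Finset.mul_sum]
  exact Finset.sum_congr rfl fun i _ => Finset.sum_congr rfl fun j _ => by ring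

theorem psdProj_posSemidef (M : Matrix (Fin d) (Fin d) ℝ) : (psdProj M).PosSemidef :=
  (exists_nearest_psd M).choose_spec.1

theorem frob_sub_psdProj_le (M : Matrix (Fin d) (Fin d) ℝ) {Q : Matrix (Fin d) (Fin d) ℝ}
    (hQ : Q.PosSemidef) : frob (M - psdProj M) ≤ frob (M - Q) :=
  (exists_nearest_psd M).choose_spec.2 Q hQ

/-- The first order optimality condition for the projection. -/
theorem frobInner_sub_psdProj_nonpos (M : Matrix (Fin d) (Fin d) ℝ)
    {Q : Matrix (Fin d) (Fin d) ℝ} (hQ : Q.PosSemidef) :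
    frobInner (M - psdProj M) (Q - psdProj M) ≤ 0 := by
  set P := psdProj M with hP
  set c := frobInner (M - P) (Q - P) with hc
  set e := frobInner (Q - P) (Q - P) with he
  have he0 : 0 ≤ e := by rw [he, ← frob_sq]; positivity
  -- Minimality of `P` against the points of the segment from `P` to `Q`: expand the squared
  -- distance and divide by `t`.
  have key : ∀ t : ℝ, 0 < t → t ≤ 1 → 2 * c ≤ t * e := by
    intro t ht ht1
    have hps : (P + t • (Q - P)).PosSemidef := by
      have : P + t • (Q - P) = (1 - t) • P + t • Q := by
        rw [smul_sub, sub_smul, one_smul]; abel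
      rw [this]
      exact ((psdProj_posSemidef M).smul (by linarith)).add (hQ.smul ht.le)
    have h1 := pow_le_pow_left₀ (frob_nonneg _) (frob_sub_psdProj_le M hps) 2
    rw [← hP, show M - (P + t • (Q - P)) = (M - P) - t • (Q - P) by abel, frob_sq, frob_sq] at h1
    generalize Q - P = D at *
    generalize M - P = R at *
    simp only [frobInner_sub_left, frobInner_sub_right, frobInner_smul_left,
      frobInner_smul_right, frobInner_comm D R, ← hc, ← he] at h1
    nlinarith
  by_contra! h
  -- If `c > 0`, this `t` makes `t * e ≤ c`, contradicting `2 * c ≤ t * e`. The `+ 1` covers `e =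
  -- 0`.
  have h1 := key (min 1 (c / (e + 1))) (by positivity) (min_le_left _ _)
  have h2 : min 1 (c / (e + 1)) * e ≤ c := by
    calc min 1 (c / (e + 1)) * e ≤ c / (e + 1) * e := by gcongr; exact min_le_right _ _
      _ = c * (e / (e + 1)) := by ring
      _ ≤ c * 1 := by gcongr; rw [div_le_one (by positivity)]; linarith
      _ = c := mul_one c
  linarith

/-- Test the optimality condition of each projection with the other one, add, and apply
Cauchy–Schwarz. -/
theorem frob_psdProj_sub_le (M M' : Matrix (Fin d) (Fin d) ℝ) :
    frob (psdProj M - psdProj M') ≤ frob (M - M') := by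
  have h1 := frobInner_sub_psdProj_nonpos M (psdProj_posSemidef M')
  have h2 := frobInner_sub_psdProj_nonpos M' (psdProj_posSemidef M)
  have h3 : frob (psdProj M - psdProj M') ^ 2 ≤ frobInner (M - M') (psdProj M - psdProj M') := by
    rw [frob_sq]
    simp only [frobInner_sub_left, frobInner_sub_right] at *
    linarith
  have h4 := h3.trans (frobInner_le_frob_mul_frob _ _)
  rcases (frob_nonneg (psdProj M - psdProj M')).eq_or_lt with h | h
  · rw [← h]; exact frob_nonneg _
  · rw [sq] at h4
    exact le_of_mul_le_mul_right h4 h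

section
attribute [local instance] Matrix.frobeniusNormedAddCommGroup Matrix.frobeniusNormedSpace

theorem continuous_psdProj : Continuous (psdProj : Matrix (Fin d) (Fin d) ℝ → _) := by
  have : LipschitzWith 1 (psdProj : Matrix (Fin d) (Fin d) ℝ → _) :=
    LipschitzWith.of_dist_le_mul fun M M' => by
      rw [dist_eq_norm, dist_eq_norm, ← frob_eq_norm, ← frob_eq_norm]
      simpa using frob_psdProj_sub_le M M'
  exact this.continuous

end

/-- Moreau decomposition with respect to the PSD cone. -/
theorem psdProj_sub_posSemidef {M : Matrix (Fin d) (Fin d) ℝ} (hM : M.IsHermitian) :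
    (psdProj M - M).PosSemidef := by
  refine Matrix.PosSemidef.of_dotProduct_mulVec_nonneg ((psdProj_posSemidef M).1.sub hM)
    fun x => ?_
  -- Moving from the projection in the direction `xxᵀ` stays in the cone, so optimality reads off
  -- the sign of the quadratic form at `x`.
  have hQ : (psdProj M + Matrix.vecMulVec x x).PosSemidef :=
    (psdProj_posSemidef M).add (by simpa using Matrix.posSemidef_vecMulVec_self_star x)
  have := frobInner_sub_psdProj_nonpos M hQ
  rw [add_sub_cancel_left, frobInner_vecMulVec, ← neg_sub, Matrix.neg_mulVec,
    dotProduct_neg] at this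
  simpa using this

/-- The test points `0` and twice the projection lie on the same ray and give the two opposite
inequalities. -/
theorem frobInner_psdProj_sub (M : Matrix (Fin d) (Fin d) ℝ) :
    frobInner (psdProj M - M) (psdProj M) = 0 := by
  have h1 := frobInner_sub_psdProj_nonpos M (Matrix.PosSemidef.zero)
  have h2 := frobInner_sub_psdProj_nonpos M
    ((psdProj_posSemidef M).add (psdProj_posSemidef M))
  simp only [frobInner_sub_left, frobInner_sub_right, frobInner_add_right] at *
  have h3 : frobInner M 0 = 0 := by simp [frobInner]
  have h4 : frobInner (psdProj M) 0 = 0 := by simp [frobInner]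
  linarith

theorem frobInner_eq_trace (A B : Matrix (Fin d) (Fin d) ℝ) :
    frobInner A B = (A.transpose * B).trace := by
  simp only [frobInner, Matrix.trace, Matrix.diag, Matrix.mul_apply, Matrix.transpose_apply]
  exact Finset.sum_comm

/-- With `A = C*C` and `B = D*D`, the trace is the squared Frobenius norm of `C D*`, which must then
vanish. -/
theorem _root_.Matrix.PosSemidef.mul_eq_zero_of_trace {A B : Matrix (Fin d) (Fin d) ℝ}
    (hA : A.PosSemidef) (hB : B.PosSemidef) (h : (A * B).trace = 0) : A * B = 0 := by
  obtain ⟨C, rfl⟩ := CStarAlgebra.nonneg_iff_eq_star_mul_self.mp hA.nonneg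
  obtain ⟨D, rfl⟩ := CStarAlgebra.nonneg_iff_eq_star_mul_self.mp hB.nonneg
  have h1 : (star (C * star D) * (C * star D)).trace = 0 := by
    rw [← h, star_mul, star_star]
    rw [show D * star C * (C * star D) = D * (star C * C * star D) by simp only [mul_assoc],
      Matrix.trace_mul_comm]
    simp only [mul_assoc]
  have h2 : C * star D = 0 := Matrix.trace_conjTranspose_mul_self_eq_zero_iff.mp h1
  calc star C * C * (star D * D) = star C * (C * star D) * D := by simp only [mul_assoc]
    _ = 0 := by rw [h2]; simp

theorem psdProj_sub_mul_psdProj {M : Matrix (Fin d) (Fin d) ℝ} (hM : M.IsHermitian) :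
    (psdProj M - M) * psdProj M = 0 := by
  refine (psdProj_sub_posSemidef hM).mul_eq_zero_of_trace (psdProj_posSemidef M) ?_
  have h := frobInner_psdProj_sub M
  rw [frobInner_eq_trace] at h
  have : (psdProj M - M).transpose = psdProj M - M := (psdProj_sub_posSemidef hM).1
  rwa [this] at h

theorem psdProj_of_posSemidef {M : Matrix (Fin d) (Fin d) ℝ} (hM : M.PosSemidef) :
    psdProj M = M := by
  have h := frob_sub_psdProj_le M hM
  have h0 : frob (M - M) = 0 := by simp [frob]
  have h1 : frobInner (M - psdProj M) (M - psdProj M) = 0 := by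
    rw [← frob_sq, le_antisymm (h.trans h0.le) (frob_nonneg _)]; simp
  rw [frobInner_eq_trace, ← Matrix.conjTranspose_eq_transpose_of_trivial] at h1
  have := Matrix.trace_conjTranspose_mul_self_eq_zero_iff.mp h1
  exact (sub_eq_zero.mp this).symm

/-- The positive part of a symmetric matrix has the same eigenvectors with positive eigenvalues. -/
theorem topSpace_psdProj {κ : ℝ} (hκ : 0 < κ) {M : Matrix (Fin d) (Fin d) ℝ}
    (hM : M.IsHermitian) : topSpace κ (psdProj M) = topSpace κ M := by
  have hmul : ∀ (A B : Matrix (Fin d) (Fin d) ℝ) (v : EuclideanSpace ℝ (Fin d)),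
      Matrix.toEuclideanLin (A * B) v = Matrix.toEuclideanLin A (Matrix.toEuclideanLin B v) :=
    fun A B v => by ext; simp [Matrix.mulVec_mulVec]
  have hsub : ∀ v : EuclideanSpace ℝ (Fin d), Matrix.toEuclideanLin (psdProj M - M) v =
      Matrix.toEuclideanLin (psdProj M) v - Matrix.toEuclideanLin M v := by simp
  unfold topSpace
  congr 1
  ext v
  refine exists_congr fun μ => and_congr_right fun hμ => ?_
  have hμ0 : μ ≠ 0 := by linarith
  simp only [Module.End.hasEigenvector_iff, Module.End.mem_eigenspace_iff]
  refine and_congr_left fun _ => ?_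
  constructor <;> intro h
  -- Here `(P - M) P = 0` applied to an eigenvector of `P` gives `μ (P - M) v = 0`.
  · have h1 := hmul (psdProj M - M) (psdProj M) v
    rw [psdProj_sub_mul_psdProj hM, h, map_smul, map_zero, LinearMap.zero_apply, eq_comm,
      smul_eq_zero, or_iff_right hμ0, hsub, sub_eq_zero] at h1
    rw [← h1, h]
  -- Conversely, `w = (P - M) v` satisfies `(P - M) w = -μ w`; since `P - M` is positive
  -- semidefinite and `μ > 0`, `w = 0`.
  · have h0 : (psdProj M - M) * M = -((psdProj M - M) * (psdProj M - M)) := by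
      rw [mul_sub (psdProj M - M) (psdProj M) M, psdProj_sub_mul_psdProj hM]; simp
    set w := Matrix.toEuclideanLin (psdProj M - M) v with hw
    have h1 := hmul (psdProj M - M) M v
    rw [h0, h, map_smul, map_neg, LinearMap.neg_apply, hmul, ← hw] at h1
    have h3 : Matrix.toEuclideanLin (psdProj M - M) w = (-μ) • w := by
      rw [neg_smul, ← h1, neg_neg]
    have h4 : 0 ≤ inner ℝ (Matrix.toEuclideanLin (psdProj M - M) w) w := by
      have := (Matrix.isPositive_toEuclideanLin_iff.mpr (psdProj_sub_posSemidef hM)).2 w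
      simpa using this
    rw [h3, inner_smul_left, real_inner_self_eq_norm_sq] at h4
    have h5 : w = 0 := by
      by_contra hne
      have : 0 < ‖w‖ ^ 2 := by positivity
      simp at h4
      nlinarith
    rw [hw, hsub, sub_eq_zero] at h5
    rw [h5, h]

end Projection

/-! ### Rényi divergence: data processing, Gaussian shifts -/

section Renyi

theorem renyiDiv_self {Y : Type*} [MeasurableSpace Y] (α : ℝ) (P : Measure Y)
    [IsProbabilityMeasure P] : renyiDiv α P P = 0 := by
  rw [renyiDiv, if_pos Measure.AbsolutelyContinuous.rfl]
  have : ∫⁻ y, (P.rnDeriv P y) ^ α ∂P = 1 := by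
    rw [lintegral_congr_ae ((Measure.rnDeriv_self P).mono fun y hy => by
      rw [hy, ENNReal.one_rpow])]
    simp
  rw [this]; simp

theorem renyiDiv_withDensity_le {Y : Type*} [MeasurableSpace Y] {α : ℝ} (hα : 1 < α)
    (Q : Measure Y) [IsProbabilityMeasure Q] {h : Y → ℝ≥0∞} (hh : Measurable h) {c : ℝ}
    (hc : ∫⁻ y, h y ^ α ∂Q ≤ ENNReal.ofReal (Real.exp ((α - 1) * c))) :
    renyiDiv α (Q.withDensity h) Q ≤ (c : EReal) := by
  rw [renyiDiv, if_pos (withDensity_absolutelyContinuous _ _)]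
  rw [lintegral_congr_ae ((Measure.rnDeriv_withDensity Q hh).mono fun y hy => by rw [hy])]
  have h1 : ENNReal.log (∫⁻ y, h y ^ α ∂Q) ≤ (((α - 1) * c : ℝ) : EReal) := by
    refine (ENNReal.log_monotone hc).trans ?_
    rw [ENNReal.log_ofReal_of_pos (Real.exp_pos _), Real.log_exp]
  have h2 : (c : EReal) = (((α - 1)⁻¹ : ℝ) : EReal) * (((α - 1) * c : ℝ) : EReal) := by
    rw [← EReal.coe_mul, inv_mul_cancel_left₀ (by linarith)]
  rw [h2]
  exact mul_le_mul_of_nonneg_left h1 (by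
    exact_mod_cast inv_nonneg.mpr (by linarith))

/-- Data processing: pushing forward does not increase `∫ (dP/dQ)^α dQ`. -/
theorem lintegral_rnDeriv_map_rpow_le {Y W : Type*} [MeasurableSpace Y] [MeasurableSpace W]
    {α : ℝ} (hα : 1 < α) (P Q : Measure Y) [IsProbabilityMeasure P] [IsProbabilityMeasure Q]
    (hPQ : P ≪ Q) {f : Y → W} (hf : Measurable f) :
    ∫⁻ w, ((P.map f).rnDeriv (Q.map f) w) ^ α ∂(Q.map f) ≤ ∫⁻ y, (P.rnDeriv Q y) ^ α ∂Q := by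
  have : IsProbabilityMeasure (P.map f) := Measure.isProbabilityMeasure_map hf.aemeasurable
  have : IsProbabilityMeasure (Q.map f) := Measure.isProbabilityMeasure_map hf.aemeasurable
  set h := P.rnDeriv Q with hh
  set g := (P.map f).rnDeriv (Q.map f) with hg
  have hhm : Measurable h := Measure.measurable_rnDeriv _ _
  have hgm : Measurable g := Measure.measurable_rnDeriv _ _
  have hα0 : 0 < α := by linarith
  set J := ∫⁻ y, h y ^ α ∂Q with hJ
  -- Truncating at `k` makes the integral `I` finite. Changing measure twice and applying Hölder
  -- yields `I ≤ J^(1/α) * I^(1 - 1/α)`, and finiteness allows cancelling the power of `I`. Monotone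
  -- convergence then removes `k`.
  have key : ∀ k : ℕ, ∫⁻ w, (min (g w) k) ^ α ∂(Q.map f) ≤ J := by
    intro k
    set u : W → ℝ≥0∞ := fun w => min (g w) k with hu
    have hum : Measurable u := hgm.min measurable_const
    set I := ∫⁻ w, u w ^ α ∂(Q.map f) with hI
    have hItop : I ≠ ⊤ := by
      refine ne_top_of_le_ne_top (b := (k : ℝ≥0∞) ^ α) ?_ ?_
      · exact ENNReal.rpow_ne_top_of_nonneg hα0.le (ENNReal.natCast_ne_top k)
      · calc I ≤ ∫⁻ _, (k : ℝ≥0∞) ^ α ∂(Q.map f) :=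
              lintegral_mono fun w => ENNReal.rpow_le_rpow (min_le_right _ _) hα0.le
          _ = _ := by simp
    have h1 : I ≤ ∫⁻ y, h y * (u (f y)) ^ (α - 1) ∂Q := by
      calc I ≤ ∫⁻ w, g w * u w ^ (α - 1) ∂(Q.map f) := by
            refine lintegral_mono fun w => ?_
            have : u w ^ α = u w * u w ^ (α - 1) := by
              conv_lhs => rw [show α = 1 + (α - 1) by ring]
              rw [ENNReal.rpow_add_of_nonneg _ _ zero_le_one (by linarith), ENNReal.rpow_one]
            change u w ^ α ≤ _
            rw [this]
            gcongr
            exact min_le_left _ _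
        _ = ∫⁻ w, u w ^ (α - 1) ∂(P.map f) :=
            lintegral_rnDeriv_mul (hPQ.map hf) (hum.pow_const _).aemeasurable
        _ = ∫⁻ y, u (f y) ^ (α - 1) ∂P := lintegral_map (hum.pow_const _) hf
        _ = _ := (lintegral_rnDeriv_mul hPQ ((hum.comp hf).pow_const _).aemeasurable).symm
    have hconj : α.HolderConjugate (α / (α - 1)) := Real.HolderConjugate.conjExponent hα
    have h2 := ENNReal.lintegral_mul_le_Lp_mul_Lq Q hconj hhm.aemeasurable
      ((hum.comp hf).pow_const (α - 1)).aemeasurable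
    have h3 : ∫⁻ y, ((u ∘ f) y ^ (α - 1)) ^ (α / (α - 1)) ∂Q = I := by
      rw [hI, lintegral_map (hum.pow_const _) hf]
      refine lintegral_congr fun y => ?_
      rw [← ENNReal.rpow_mul, mul_div_cancel₀ _ (by linarith)]; rfl
    simp only [Pi.mul_apply, Function.comp_apply] at h2 h3
    rw [h3] at h2
    have h4 : I ≤ J ^ (1 / α) * I ^ (1 / (α / (α - 1))) := h1.trans h2
    have h5 : (1 / (α / (α - 1))) = 1 - 1 / α := by
      field_simp
    rw [h5] at h4
    rcases eq_or_ne I 0 with h0 | h0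
    · rw [h0]; exact zero_le
    have h6 : I ^ (1 / α) ≤ J ^ (1 / α) := by
      have : I = I ^ (1 / α) * I ^ (1 - 1 / α) := by
        rw [← ENNReal.rpow_add _ _ h0 hItop]; simp
      rw [this] at h4
      have hx0 : I ^ (1 - 1 / α) ≠ 0 := by
        simp [ENNReal.rpow_eq_zero_iff, h0, hItop]
      have hxt : I ^ (1 - 1 / α) ≠ ⊤ := by
        simp [ENNReal.rpow_eq_top_iff, h0, hItop]
      rw [← this] at h4
      nth_rw 1 [this] at h4
      exact (ENNReal.mul_le_mul_iff_left hx0 hxt).mp h4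
    exact (ENNReal.rpow_le_rpow_iff (by positivity)).mp h6
  have hsup : ∀ w, g w ^ α = ⨆ k : ℕ, (min (g w) k) ^ α := by
    intro w
    have hmono : Monotone fun k : ℕ => (min (g w) (k : ℝ≥0∞)) ^ α := fun a b hab =>
      ENNReal.rpow_le_rpow (min_le_min_left _ (by exact_mod_cast hab)) hα0.le
    refine tendsto_nhds_unique ?_ (tendsto_atTop_iSup hmono)
    refine ((ENNReal.continuous_rpow_const (y := α)).tendsto (g w)).comp ?_
    have : Filter.Tendsto (fun k : ℕ => min (g w) (k : ℝ≥0∞)) Filter.atTop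
        (nhds (min (g w) ⊤)) := tendsto_const_nhds.min ENNReal.tendsto_nat_nhds_top
    simpa using this
  simp_rw [hsup]
  rw [lintegral_iSup (fun k => (hgm.min measurable_const).pow_const _)]
  · exact iSup_le key
  · exact fun a b hab w => ENNReal.rpow_le_rpow (min_le_min_left _ (by exact_mod_cast hab)) hα0.le

theorem renyiDiv_map_le {Y W : Type*} [MeasurableSpace Y] [MeasurableSpace W]
    {α : ℝ} (hα : 1 < α) (P Q : Measure Y) [IsProbabilityMeasure P] [IsProbabilityMeasure Q]
    {f : Y → W} (hf : Measurable f) : renyiDiv α (P.map f) (Q.map f) ≤ renyiDiv α P Q := by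
  by_cases hPQ : P ≪ Q
  · rw [renyiDiv, renyiDiv, if_pos hPQ, if_pos (hPQ.map hf)]
    exact mul_le_mul_of_nonneg_left
      (ENNReal.log_monotone (lintegral_rnDeriv_map_rpow_le hα P Q hPQ hf))
      (by exact_mod_cast inv_nonneg.mpr (by linarith))
  · simp [renyiDiv, hPQ]

/-- The density of `N(a, v)` with respect to `N(b, v)`. -/
noncomputable def gaussianShiftDensity (v : ℝ≥0) (a b x : ℝ) : ℝ :=
  Real.exp (((a - b) / v) * x - (a ^ 2 - b ^ 2) / (2 * v))

theorem measurable_gaussianShiftDensity (v : ℝ≥0) (a b : ℝ) :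
    Measurable (gaussianShiftDensity v a b) := by
  unfold gaussianShiftDensity
  fun_prop

theorem gaussianReal_eq_withDensity {v : ℝ≥0} (hv : v ≠ 0) (a b : ℝ) :
    gaussianReal a v =
      (gaussianReal b v).withDensity fun x => ENNReal.ofReal (gaussianShiftDensity v a b x) := by
  have hm : Measurable fun x => ENNReal.ofReal (gaussianShiftDensity v a b x) :=
    (measurable_gaussianShiftDensity v a b).ennreal_ofReal
  rw [gaussianReal_of_var_ne_zero _ hv, gaussianReal_of_var_ne_zero _ hv,
    ← withDensity_mul _ (measurable_gaussianPDF _ _) hm]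
  congr 1
  ext x
  have hv' : (v : ℝ) ≠ 0 := by exact_mod_cast hv
  rw [Pi.mul_apply, gaussianPDF, gaussianPDF, ← ENNReal.ofReal_mul (gaussianPDFReal_nonneg _ _ _)]
  congr 1
  rw [gaussianPDFReal, gaussianPDFReal, gaussianShiftDensity, mul_assoc _ _ (Real.exp (_ - _)),
    ← Real.exp_add]
  congr 2
  field_simp
  ring

/-- The power of the density is still the exponential of an affine function, so the Gaussian moment
generating function at `α (a - b) / v` evaluates the integral. -/
theorem lintegral_gaussianShiftDensity_rpow {v : ℝ≥0} (hv : v ≠ 0) (a b α : ℝ) :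
    ∫⁻ x, ENNReal.ofReal (gaussianShiftDensity v a b x) ^ α ∂(gaussianReal b v) =
      ENNReal.ofReal (Real.exp (α * (α - 1) * (a - b) ^ 2 / (2 * v))) := by
  have hv' : (v : ℝ) ≠ 0 := by exact_mod_cast hv
  have h1 : ∀ x, ENNReal.ofReal (gaussianShiftDensity v a b x) ^ α =
      ENNReal.ofReal (Real.exp (-(α * ((a ^ 2 - b ^ 2) / (2 * v)))) *
        Real.exp ((α * ((a - b) / v)) * x)) := by
    intro x
    rw [gaussianShiftDensity, ENNReal.ofReal_rpow_of_pos (Real.exp_pos _), ← Real.exp_mul,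
      ← Real.exp_add]
    congr 2
    ring
  simp_rw [h1]
  rw [← ofReal_integral_eq_lintegral_ofReal ((integrable_exp_mul_gaussianReal _).const_mul _)
    (ae_of_all _ fun x => by positivity), integral_const_mul]
  have h2 := congrFun (mgf_id_gaussianReal (μ := b) (v := v)) (α * ((a - b) / v))
  simp only [mgf, id] at h2
  rw [h2, ← Real.exp_add]
  congr 2
  field_simp
  ring

variable {ι : Type*} [Fintype ι]

theorem lintegral_pi_prod {μ : ι → Measure ℝ} [∀ i, IsProbabilityMeasure (μ i)]
    {f : ι → ℝ → ℝ≥0∞} (hf : ∀ i, Measurable (f i)) :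
    ∫⁻ x, ∏ i, f i (x i) ∂(Measure.pi μ) = ∏ i, ∫⁻ t, f i t ∂(μ i) := by
  have hind : iIndepFun (fun i (x : ι → ℝ) => f i (x i)) (Measure.pi μ) :=
    iIndepFun_pi fun i => (hf i).aemeasurable
  rw [lintegral_prod_eq_prod_lintegral_of_indepFun Finset.univ _ hind
    fun i => (hf i).comp (measurable_pi_apply i)]
  refine Finset.prod_congr rfl fun i _ => ?_
  rw [← lintegral_map (hf i) (measurable_pi_apply i)]
  rw [(measurePreserving_eval μ i).map_eq]

theorem pi_withDensity {μ : ι → Measure ℝ} [∀ i, IsProbabilityMeasure (μ i)]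
    {f : ι → ℝ → ℝ≥0∞} (hf : ∀ i, Measurable (f i))
    [∀ i, IsProbabilityMeasure ((μ i).withDensity (f i))] :
    Measure.pi (fun i => (μ i).withDensity (f i)) =
      (Measure.pi μ).withDensity fun x => ∏ i, f i (x i) := by
  refine Measure.pi_eq fun s hs => ?_
  rw [withDensity_apply _ (MeasurableSet.univ_pi hs),
    ← lintegral_indicator (MeasurableSet.univ_pi hs)]
  have h1 : ∀ x : ι → ℝ, (Set.univ.pi s).indicator (fun x => ∏ i, f i (x i)) x =
      ∏ i, (s i).indicator (f i) (x i) := by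
    intro x
    by_cases hx : x ∈ Set.univ.pi s
    · rw [Set.indicator_of_mem hx]
      exact Finset.prod_congr rfl fun i _ => (Set.indicator_of_mem (hx i trivial) _).symm
    · rw [Set.indicator_of_notMem hx]
      simp only [Set.mem_univ_pi, not_forall] at hx
      obtain ⟨i, hi⟩ := hx
      exact (Finset.prod_eq_zero (Finset.mem_univ i) (Set.indicator_of_notMem hi _)).symm
  simp_rw [h1]
  rw [lintegral_pi_prod fun i => (hf i).indicator (hs i)]
  refine Finset.prod_congr rfl fun i _ => ?_
  rw [lintegral_indicator (hs i), withDensity_apply _ (hs i)]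

/-- The Rényi divergence of two Gaussian product measures with the same variances. -/
theorem renyiDiv_pi_gaussianReal_le {v : ℝ≥0} (hv : v ≠ 0) (a b : ι → ℝ) {α ρ : ℝ} (hα : 1 < α)
    (hab : ∑ i, (a i - b i) ^ 2 ≤ 2 * v * ρ) :
    renyiDiv α (Measure.pi fun i => gaussianReal (a i) v)
      (Measure.pi fun i => gaussianReal (b i) v) ≤ ((ρ * α : ℝ) : EReal) := by
  have hm : ∀ i, Measurable fun x => ENNReal.ofReal (gaussianShiftDensity v (a i) (b i) x) :=
    fun i => (measurable_gaussianShiftDensity v (a i) (b i)).ennreal_ofReal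
  have hpi : Measure.pi (fun i => gaussianReal (a i) v) =
      (Measure.pi fun i => gaussianReal (b i) v).withDensity
        fun x => ∏ i, ENNReal.ofReal (gaussianShiftDensity v (a i) (b i) (x i)) := by
    have h1 : ∀ i, IsProbabilityMeasure ((gaussianReal (b i) v).withDensity
        fun x => ENNReal.ofReal (gaussianShiftDensity v (a i) (b i) x)) := fun i => by
      rw [← gaussianReal_eq_withDensity hv]; infer_instance
    rw [← pi_withDensity hm]
    congr 1
    ext1 i
    exact gaussianReal_eq_withDensity hv _ _
  have hv' : 0 < (v : ℝ) := by exact_mod_cast pos_iff_ne_zero.mpr hv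
  rw [hpi]
  refine renyiDiv_withDensity_le hα _
    (Finset.measurable_prod _ fun i _ => (hm i).comp (measurable_pi_apply i)) ?_
  have h2 : ∀ x : ι → ℝ, (∏ i, ENNReal.ofReal (gaussianShiftDensity v (a i) (b i) (x i))) ^ α =
      ∏ i, ENNReal.ofReal (gaussianShiftDensity v (a i) (b i) (x i)) ^ α := fun x =>
    (ENNReal.prod_rpow_of_nonneg (by linarith)).symm
  simp only [Function.comp_apply]
  rw [lintegral_congr h2]
  rw [lintegral_pi_prod (f := fun i x => ENNReal.ofReal (gaussianShiftDensity v (a i) (b i) x) ^ α)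
    fun i => (hm i).pow_const α]
  simp_rw [lintegral_gaussianShiftDensity_rpow hv]
  rw [← ENNReal.ofReal_prod_of_nonneg fun i _ => (Real.exp_pos _).le, ← Real.exp_sum]
  refine ENNReal.ofReal_le_ofReal (Real.exp_le_exp.mpr ?_)
  rw [← Finset.sum_div, ← Finset.mul_sum, div_le_iff₀ (by positivity)]
  nlinarith [mul_le_mul_of_nonneg_left hab (mul_nonneg (by linarith : (0 : ℝ) ≤ α)
    (by linarith : 0 ≤ α - 1))]

end Renyi

/-! ### Spectral projections: description and measurability -/

section Spectral

variable {d : ℕ}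

instance instBorelSpaceMatrix (d : ℕ) : BorelSpace (Matrix (Fin d) (Fin d) ℝ) :=
  inferInstanceAs (BorelSpace (Fin d → Fin d → ℝ))

instance instPseudoMetrizableSpaceMatrix (d : ℕ) :
    TopologicalSpace.PseudoMetrizableSpace (Matrix (Fin d) (Fin d) ℝ) :=
  inferInstanceAs (TopologicalSpace.PseudoMetrizableSpace (Fin d → Fin d → ℝ))

theorem toEuclideanCLM_projMatrix (V : Submodule ℝ (EuclideanSpace ℝ (Fin d))) :
    Matrix.toEuclideanCLM (𝕜 := ℝ) (projMatrix V) = V.starProjection := by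
  simp [projMatrix]

theorem projMatrix_orthogonal (V : Submodule ℝ (EuclideanSpace ℝ (Fin d))) :
    projMatrix Vᗮ = 1 - projMatrix V := by
  refine (Matrix.toEuclideanCLM (n := Fin d) (𝕜 := ℝ)).injective
    (?_ : Matrix.toEuclideanCLM (𝕜 := ℝ) _ = Matrix.toEuclideanCLM (𝕜 := ℝ) _)
  rw [map_sub, map_one, toEuclideanCLM_projMatrix, toEuclideanCLM_projMatrix,
    Submodule.starProjection_orthogonal]
  rfl

theorem mem_topSpace_of_apply_eq {κ μ : ℝ} {Z : Matrix (Fin d) (Fin d) ℝ}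
    {v : EuclideanSpace ℝ (Fin d)} (hμ : κ / 2 ≤ μ)
    (h : Matrix.toEuclideanCLM (𝕜 := ℝ) Z v = μ • v) : v ∈ topSpace κ Z := by
  rcases eq_or_ne v 0 with rfl | hv
  · exact zero_mem _
  · exact Submodule.subset_span ⟨μ, hμ,
      Module.End.hasEigenvector_iff.mpr ⟨Module.End.mem_eigenspace_iff.mpr h, hv⟩⟩

theorem inner_toEuclideanCLM_comm {Z : Matrix (Fin d) (Fin d) ℝ} (hZ : Z.IsHermitian)
    (x y : EuclideanSpace ℝ (Fin d)) :
    inner ℝ (Matrix.toEuclideanCLM (𝕜 := ℝ) Z x) y =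
      inner ℝ x (Matrix.toEuclideanCLM (𝕜 := ℝ) Z y) :=
  Matrix.isSymmetric_toEuclideanLin_iff.mpr hZ x y

theorem mem_topSpace_orthogonal_of_apply_eq {κ μ : ℝ} {Z : Matrix (Fin d) (Fin d) ℝ}
    (hZ : Z.IsHermitian) {v : EuclideanSpace ℝ (Fin d)} (hμ : μ < κ / 2)
    (h : Matrix.toEuclideanCLM (𝕜 := ℝ) Z v = μ • v) : v ∈ (topSpace κ Z)ᗮ := by
  rw [topSpace, Submodule.mem_orthogonal]
  intro u hu
  induction hu using Submodule.span_induction with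
  | mem x hx =>
    obtain ⟨ν, hν, hx⟩ := hx
    have hx' : Matrix.toEuclideanCLM (𝕜 := ℝ) Z x = ν • x := hx.apply_eq_smul
    have := inner_toEuclideanCLM_comm hZ x v
    rw [hx', h, inner_smul_left, inner_smul_right] at this
    exact (mul_eq_mul_right_iff.mp this).resolve_left (by simp; linarith)
  | zero => simp
  | add x y _ _ hx hy => rw [inner_add_left, hx, hy, add_zero]
  | smul a x _ hx => rw [inner_smul_left, hx, mul_zero]

theorem toEuclideanCLM_eigenvectorBasis {Z : Matrix (Fin d) (Fin d) ℝ} (hZ : Z.IsHermitian)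
    (i : Fin d) : Matrix.toEuclideanCLM (𝕜 := ℝ) Z (hZ.eigenvectorBasis i) =
      hZ.eigenvalues i • hZ.eigenvectorBasis i := by
  ext j
  exact congrFun (hZ.mulVec_eigenvectorBasis i) j

theorem starProjection_topSpace_orthogonal_eigenvectorBasis {κ : ℝ} {Z : Matrix (Fin d) (Fin d) ℝ}
    (hZ : Z.IsHermitian) (i : Fin d) :
    (topSpace κ Z)ᗮ.starProjection (hZ.eigenvectorBasis i) =
      (if hZ.eigenvalues i < κ / 2 then (1 : ℝ) else 0) • hZ.eigenvectorBasis i := by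
  split_ifs with h
  · rw [one_smul, Submodule.starProjection_eq_self_iff]
    exact mem_topSpace_orthogonal_of_apply_eq hZ h (toEuclideanCLM_eigenvectorBasis hZ i)
  · rw [zero_smul, Submodule.starProjection_apply_eq_zero_iff]
    exact Submodule.le_orthogonal_orthogonal _
      (mem_topSpace_of_apply_eq (not_lt.mp h) (toEuclideanCLM_eigenvectorBasis hZ i))

/-- A rational function of `Z` which approximates the projection onto the span of the eigenvectors
with eigenvalue less than `a`. -/
noncomputable def lowApprox (a : ℝ) (m : ℕ) (Z : Matrix (Fin d) (Fin d) ℝ) :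
    Matrix (Fin d) (Fin d) ℝ :=
  (1 + (m : ℝ) • (a⁻¹ • Z) ^ m)⁻¹

/-- The factor `m` decides the boundary case: it sends `y = 1` to `0`, as needed because eigenvalues
equal to `κ / 2` belong to the top space. It is harmless for `y < 1`, where the power decays
geometrically. -/
theorem tendsto_inv_one_add_mul_pow {y : ℝ} (hy : 0 ≤ y) :
    Filter.Tendsto (fun m : ℕ => (1 + (m : ℝ) * y ^ m)⁻¹) Filter.atTop
      (nhds (if y < 1 then 1 else 0)) := by
  split_ifs with h
  · have := (tendsto_self_mul_const_pow_of_lt_one hy h).const_add 1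
    simpa using this.inv₀ (by simp)
  · refine Filter.Tendsto.inv_tendsto_atTop ?_
    refine Filter.tendsto_atTop_mono (fun m => ?_) tendsto_natCast_atTop_atTop
    have : (1 : ℝ) ≤ y ^ m := one_le_pow₀ (not_lt.mp h)
    nlinarith [(Nat.cast_nonneg m : (0 : ℝ) ≤ m)]

theorem toEuclideanCLM_pow_apply {Z : Matrix (Fin d) (Fin d) ℝ} {v : EuclideanSpace ℝ (Fin d)}
    {μ : ℝ} (h : Matrix.toEuclideanCLM (𝕜 := ℝ) Z v = μ • v) (m : ℕ) :
    Matrix.toEuclideanCLM (𝕜 := ℝ) (Z ^ m) v = μ ^ m • v := by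
  induction m with
  | zero => simp
  | succ m ih => rw [pow_succ, map_mul, mul_apply_eq_comp, h, map_smul, ih, smul_smul,
      pow_succ, mul_comm]

theorem lowApprox_apply {a : ℝ} (ha : 0 < a) (m : ℕ) {Z : Matrix (Fin d) (Fin d) ℝ}
    (hZ : Z.PosSemidef) {v : EuclideanSpace ℝ (Fin d)} {μ : ℝ} (hμ : 0 ≤ μ)
    (h : Matrix.toEuclideanCLM (𝕜 := ℝ) Z v = μ • v) :
    Matrix.toEuclideanCLM (𝕜 := ℝ) (lowApprox a m Z) v =
      (1 + (m : ℝ) * (a⁻¹ * μ) ^ m)⁻¹ • v := by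
  set W : Matrix (Fin d) (Fin d) ℝ := 1 + (m : ℝ) • (a⁻¹ • Z) ^ m with hW
  have hWpos : W.PosDef := Matrix.PosDef.one.add_posSemidef
    (((hZ.smul (inv_nonneg.mpr ha.le)).pow m).smul (Nat.cast_nonneg m))
  have hc : 0 < 1 + (m : ℝ) * (a⁻¹ * μ) ^ m := by positivity
  have h1 : Matrix.toEuclideanCLM (𝕜 := ℝ) (a⁻¹ • Z) v = (a⁻¹ * μ) • v := by
    rw [map_smul, smul_apply, h, smul_smul]
  have h2 : Matrix.toEuclideanCLM (𝕜 := ℝ) W v = (1 + (m : ℝ) * (a⁻¹ * μ) ^ m) • v := by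
    rw [hW, map_add, map_one, map_smul, add_apply,
      smul_apply, toEuclideanCLM_pow_apply h1, add_smul, smul_smul, one_smul]
    rfl
  have h3 : Matrix.toEuclideanCLM (𝕜 := ℝ) W⁻¹ (Matrix.toEuclideanCLM (𝕜 := ℝ) W v) = v := by
    rw [← mul_apply_eq_comp, ← map_mul,
      Matrix.nonsing_inv_mul _ ((Matrix.isUnit_iff_isUnit_det _).mp hWpos.isUnit), map_one]
    rfl
  rw [h2, map_smul] at h3
  change Matrix.toEuclideanCLM (𝕜 := ℝ) W⁻¹ v = _
  conv_rhs => rw [← h3]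
  rw [smul_smul, inv_mul_cancel₀ hc.ne', one_smul]

/-- On an eigenbasis of `Z` this is the scalar limit above; entries are then read off from the
standard basis vectors. -/
theorem tendsto_lowApprox {κ : ℝ} (hκ : 0 < κ) {Z : Matrix (Fin d) (Fin d) ℝ}
    (hZ : Z.PosSemidef) :
    Filter.Tendsto (fun m => lowApprox (κ / 2) m Z) Filter.atTop
      (nhds (projMatrix (topSpace κ Z)ᗮ)) := by
  have key : ∀ x : EuclideanSpace ℝ (Fin d), Filter.Tendsto
      (fun m => Matrix.toEuclideanCLM (𝕜 := ℝ) (lowApprox (κ / 2) m Z) x) Filter.atTop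
      (nhds ((topSpace κ Z)ᗮ.starProjection x)) := by
    intro x
    rw [← hZ.1.eigenvectorBasis.sum_repr' x]
    simp only [map_sum, map_smul]
    refine tendsto_finsetSum _ fun i _ => Filter.Tendsto.const_smul ?_ _
    rw [starProjection_topSpace_orthogonal_eigenvectorBasis]
    simp only [lowApprox_apply (half_pos hκ) _ hZ (hZ.eigenvalues_nonneg i)
      (toEuclideanCLM_eigenvectorBasis hZ.1 i)]
    refine Filter.Tendsto.smul_const ?_ _
    have := tendsto_inv_one_add_mul_pow (y := (κ / 2)⁻¹ * hZ.1.eigenvalues i)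
      (mul_nonneg (by positivity) (hZ.eigenvalues_nonneg i))
    convert this using 3
    rw [inv_mul_lt_iff₀ (by positivity), mul_one]
  have entry : ∀ (M : Matrix (Fin d) (Fin d) ℝ) (i j : Fin d),
      M i j = Matrix.toEuclideanCLM (𝕜 := ℝ) M (EuclideanSpace.single j 1) i := by
    intro M i j
    rw [Matrix.ofLp_toEuclideanCLM]
    simp
  refine tendsto_pi_nhds.mpr fun i => tendsto_pi_nhds.mpr fun j => ?_
  have h1 := ((EuclideanSpace.proj (𝕜 := ℝ) i).continuous.tendsto _).comp
    (key (EuclideanSpace.single j 1))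
  rw [← toEuclideanCLM_projMatrix] at h1
  rw [entry (projMatrix _)]
  refine h1.congr fun m => ?_
  rw [entry (lowApprox _ m Z)]
  rfl

/-- The adjugate formula also holds at singular matrices, where both sides are zero, so inversion is
Borel on the whole space. -/
theorem measurable_matrix_inv :
    Measurable fun M : Matrix (Fin d) (Fin d) ℝ => M⁻¹ := by
  have h1 : (fun M : Matrix (Fin d) (Fin d) ℝ => M⁻¹) = fun M => (M.det)⁻¹ • M.adjugate := by
    ext1 M
    rw [Matrix.inv_def, Ring.inverse_eq_inv']
  rw [h1]
  have hd : Measurable fun M : Matrix (Fin d) (Fin d) ℝ => (M.det)⁻¹ :=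
    (Continuous.matrix_det continuous_id).measurable.inv
  have ha : Measurable fun M : Matrix (Fin d) (Fin d) ℝ => M.adjugate :=
    (Continuous.matrix_adjugate continuous_id).measurable
  refine measurable_pi_lambda _ fun i => measurable_pi_lambda _ fun j => ?_
  exact hd.mul ((measurable_pi_apply j).comp ((measurable_pi_apply i).comp ha))

theorem measurable_lowApprox (a : ℝ) (m : ℕ) :
    Measurable (lowApprox a m : Matrix (Fin d) (Fin d) ℝ → _) := by
  have h : Continuous fun Z : Matrix (Fin d) (Fin d) ℝ => 1 + (m : ℝ) • (a⁻¹ • Z) ^ m := by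
    fun_prop
  exact measurable_matrix_inv.comp h.measurable

/-- A pointwise limit of Borel maps. The approximation is available for positive semidefinite
matrices, hence the composition with `psdProj`. -/
theorem measurable_projMatrix_topSpace_psdProj {κ : ℝ} (hκ : 0 < κ) :
    Measurable fun Z : Matrix (Fin d) (Fin d) ℝ => projMatrix (topSpace κ (psdProj Z)) := by
  have h1 : Measurable fun Z : Matrix (Fin d) (Fin d) ℝ =>
      projMatrix (topSpace κ (psdProj Z))ᗮ :=
    measurable_of_tendsto_metrizable
      (fun m => (measurable_lowApprox (κ / 2) m).comp continuous_psdProj.measurable)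
      (tendsto_pi_nhds.mpr fun Z => tendsto_lowApprox hκ (psdProj_posSemidef Z))
  have h2 : Continuous fun M : Matrix (Fin d) (Fin d) ℝ => 1 - M := by fun_prop
  simpa only [Function.comp_def, projMatrix_orthogonal, sub_sub_cancel] using h2.measurable.comp h1

/-- The output of `WeakPPC` as a function of the noisy covariance. -/
noncomputable def output (κ K : ℝ) (Z : Matrix (Fin d) (Fin d) ℝ) :
    Submodule ℝ (EuclideanSpace ℝ (Fin d)) × Matrix (Fin d) (Fin d) ℝ :=
  (topSpace κ Z, precond K (topSpace κ Z))

theorem measurable_output_psdProj {κ : ℝ} (hκ : 0 < κ) (K : ℝ) :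
    Measurable fun Z : Matrix (Fin d) (Fin d) ℝ => output κ K (psdProj Z) := by
  have h1 := measurable_projMatrix_topSpace_psdProj (d := d) hκ
  have h2 : Continuous fun M : Matrix (Fin d) (Fin d) ℝ => (1 / √K) • M + (1 - M) := by fun_prop
  refine Measurable.prodMk (measurable_comap_iff.mpr h1) ?_
  simpa only [Function.comp_def, precond, projMatrix_orthogonal] using h2.measurable.comp h1

end Spectral

/-! ### Privacy -/

section Privacy

variable {d n : ℕ}

/-- The symmetric matrix with prescribed entries. -/
def symMat (g : Sym2 (Fin d) → ℝ) : Matrix (Fin d) (Fin d) ℝ := Matrix.of fun i j => g s(i, j)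

theorem symMat_isHermitian (g : Sym2 (Fin d) → ℝ) : (symMat g).IsHermitian := by
  ext i j
  simp [symMat, Sym2.eq_swap]

theorem measurable_symMat : Measurable (symMat : (Sym2 (Fin d) → ℝ) → _) :=
  measurable_pi_lambda _ fun _ => measurable_pi_lambda _ fun _ => measurable_pi_apply _

/-- The entries of a symmetric matrix, indexed by unordered pairs. -/
def symEntries {M : Matrix (Fin d) (Fin d) ℝ} (hM : M.IsHermitian) : Sym2 (Fin d) → ℝ :=
  Sym2.lift ⟨fun i j => M i j, fun i j => by simpa using hM.apply j i⟩

theorem symMat_symEntries {M : Matrix (Fin d) (Fin d) ℝ} (hM : M.IsHermitian) :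
    symMat (symEntries hM) = M := by
  ext i j
  simp [symMat, symEntries]

theorem truncCov_isHermitian (τ : ℝ) (X : Fin n → EuclideanSpace ℝ (Fin d)) :
    (truncCov τ X).IsHermitian := by
  classical
  ext i j
  simp [truncCov, Matrix.sum_apply, Matrix.vecMulVec_apply, mul_comm]

theorem naivePCE_eq_map (cS cN ρ β κ : ℝ) (X : Fin n → EuclideanSpace ℝ (Fin d)) :
    naivePCE cS cN ρ β κ X =
      (Measure.pi fun _ : Sym2 (Fin d) =>
        gaussianReal 0 (noiseScale cN d n ρ β κ ^ 2).toNNReal).map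
        fun g => psdProj (truncCov (threshold cS d n β κ) X + symMat g) := by
  rw [naivePCE, gue]
  have h : Continuous fun N : Matrix (Fin d) (Fin d) ℝ =>
      psdProj (truncCov (threshold cS d n β κ) X + N) :=
    continuous_psdProj.comp (continuous_const.add continuous_id)
  exact Measure.map_map h.measurable measurable_symMat

theorem measurable_psdProj_add_symMat (T : Matrix (Fin d) (Fin d) ℝ) :
    Measurable fun g => psdProj (T + symMat g) := by
  have h : Continuous fun N : Matrix (Fin d) (Fin d) ℝ => psdProj (T + N) :=
    continuous_psdProj.comp (continuous_const.add continuous_id)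
  exact h.measurable.comp measurable_symMat

theorem output_psdProj_psdProj (κ K : ℝ) (Z : Matrix (Fin d) (Fin d) ℝ) :
    output κ K (psdProj (psdProj Z)) = output κ K (psdProj Z) := by
  rw [psdProj_of_posSemidef (psdProj_posSemidef Z)]

/-- Measurability of `output` is known only after `psdProj`. As `naivePCE` is carried by the fixed
points of `psdProj`, the two maps agree almost everywhere and the successive push-forwards can be
composed. -/
theorem weakPPC_eq_map (cS cN ρ β : ℝ) {κ : ℝ} (hκ : 0 < κ) (K : ℝ)
    (X : Fin n → EuclideanSpace ℝ (Fin d)) :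
    weakPPC cS cN ρ β κ K X =
      (Measure.pi fun _ : Sym2 (Fin d) =>
        gaussianReal 0 (noiseScale cN d n ρ β κ ^ 2).toNNReal).map
        fun g => output κ K (psdProj (truncCov (threshold cS d n β κ) X + symMat g)) := by
  have hf := measurable_psdProj_add_symMat (truncCov (threshold cS d n β κ) X)
  have hG := measurable_output_psdProj (d := d) hκ K
  rw [weakPPC, naivePCE_eq_map]
  have hae : (fun Z => output κ K Z) =ᵐ[(Measure.pi fun _ : Sym2 (Fin d) =>
        gaussianReal 0 (noiseScale cN d n ρ β κ ^ 2).toNNReal).map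
        fun g => psdProj (truncCov (threshold cS d n β κ) X + symMat g)]
      fun Z => output κ K (psdProj Z) := by
    have hset : MeasurableSet {Z : Matrix (Fin d) (Fin d) ℝ | psdProj Z = Z} :=
      (isClosed_eq continuous_psdProj continuous_id).measurableSet
    have : ∀ᵐ Z ∂((Measure.pi fun _ : Sym2 (Fin d) =>
        gaussianReal 0 (noiseScale cN d n ρ β κ ^ 2).toNNReal).map
        fun g => psdProj (truncCov (threshold cS d n β κ) X + symMat g)), psdProj Z = Z := by
      rw [ae_map_iff hf.aemeasurable hset]
      exact ae_of_all _ fun g => psdProj_of_posSemidef (psdProj_posSemidef _)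
    filter_upwards [this] with Z hZ
    rw [hZ]
  change Measure.map (fun Z => output κ K Z) _ = _
  rw [Measure.map_congr hae, Measure.map_map hG hf]
  simp only [Function.comp_def, output_psdProj_psdProj]

/-- Adding the noise to the truncated covariance is the Gaussian mechanism. -/
theorem weakPPC_eq_map_gaussian (cS cN ρ β : ℝ) {κ : ℝ} (hκ : 0 < κ) (K : ℝ)
    (X : Fin n → EuclideanSpace ℝ (Fin d)) :
    weakPPC cS cN ρ β κ K X =
      (Measure.pi fun s : Sym2 (Fin d) =>
        gaussianReal (symEntries (truncCov_isHermitian (threshold cS d n β κ) X) s)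
          (noiseScale cN d n ρ β κ ^ 2).toNNReal).map
        fun g => output κ K (psdProj (symMat g)) := by
  set t := symEntries (truncCov_isHermitian (threshold cS d n β κ) X) with ht
  set v := (noiseScale cN d n ρ β κ ^ 2).toNNReal
  have h1 : (Measure.pi fun s : Sym2 (Fin d) => gaussianReal (t s) v) =
      (Measure.pi fun _ : Sym2 (Fin d) => gaussianReal 0 v).map fun g s => t s + g s := by
    have h2 : ∀ s, gaussianReal (t s) v = (gaussianReal 0 v).map (t s + ·) := fun s => by
      rw [gaussianReal_map_const_add, zero_add]
    have h3 : ∀ s, SigmaFinite ((gaussianReal 0 v).map (t s + ·)) := fun s => by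
      rw [← h2]; infer_instance
    simp_rw [h2]
    exact (Measure.pi_map_pi fun s => (measurable_const_add (t s)).aemeasurable).symm
  have hadd : Measurable fun (g : Sym2 (Fin d) → ℝ) s => t s + g s :=
    measurable_pi_lambda _ fun s => (measurable_pi_apply s).const_add _
  have hG := Measure.map_map (μ := Measure.pi fun _ : Sym2 (Fin d) => gaussianReal 0 v)
    ((measurable_output_psdProj hκ K).comp measurable_symMat) hadd
  simp only [Function.comp_def] at hG
  have hsym : ∀ g, symMat (fun s => t s + g s) =
      truncCov (threshold cS d n β κ) X + symMat g := fun g => by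
    rw [← symMat_symEntries (truncCov_isHermitian (threshold cS d n β κ) X)]
    rfl
  rw [weakPPC_eq_map _ _ _ _ hκ, h1, hG]
  simp only [hsym]
  rfl

theorem isProbabilityMeasure_weakPPC (cS cN ρ β : ℝ) {κ : ℝ} (hκ : 0 < κ) (K : ℝ)
    (X : Fin n → EuclideanSpace ℝ (Fin d)) : IsProbabilityMeasure (weakPPC cS cN ρ β κ K X) := by
  rw [weakPPC_eq_map_gaussian _ _ _ _ hκ]
  exact Measure.isProbabilityMeasure_map
    ((measurable_output_psdProj hκ K).comp measurable_symMat).aemeasurable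

/-- Every unordered pair comes from at least one ordered pair. This compares the distance of the
independent entries with the Frobenius distance. -/
theorem sum_sym2_le {F : Sym2 (Fin d) → ℝ} (hF : ∀ s, 0 ≤ F s) :
    ∑ s, F s ≤ ∑ i, ∑ j, F s(i, j) := by
  classical
  rw [← Fintype.sum_prod_type' (fun i j => F s(i, j)),
    ← Finset.sum_fiberwise (Finset.univ : Finset (Fin d × Fin d)) (fun p => s(p.1, p.2))]
  refine Finset.sum_le_sum fun s _ => ?_
  induction s using Sym2.ind with
  | _ i j =>
    exact Finset.single_le_sum (f := fun p : Fin d × Fin d => F s(p.1, p.2))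
      (fun p _ => hF _) (a := (i, j)) (by simp)

theorem frob_smul_sq (a : ℝ) (A : Matrix (Fin d) (Fin d) ℝ) :
    frob (a • A) ^ 2 = a ^ 2 * frob A ^ 2 := by
  rw [frob_sq, frob_sq, frobInner_smul_left, frobInner_smul_right]
  ring

theorem frobInner_vecMulVec_vecMulVec (x y : EuclideanSpace ℝ (Fin d)) :
    frobInner (Matrix.vecMulVec x.ofLp x.ofLp) (Matrix.vecMulVec y.ofLp y.ofLp) =
      inner ℝ x y ^ 2 := by
  have : inner ℝ x y = ∑ i, x i * y i := by simp [PiLp.inner_apply, mul_comm]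
  rw [this, sq, Finset.sum_mul_sum]
  simp only [frobInner, Matrix.vecMulVec_apply]
  exact Finset.sum_congr rfl fun i _ => Finset.sum_congr rfl fun j _ => by ring

open Classical in
/-- The contribution of one sample to the truncated covariance. -/
noncomputable def truncOuter (τ : ℝ) (x : EuclideanSpace ℝ (Fin d)) :
    Matrix (Fin d) (Fin d) ℝ :=
  if ‖x‖ ^ 2 ≤ τ then Matrix.vecMulVec x.ofLp x.ofLp else 0

theorem truncCov_eq (τ : ℝ) (X : Fin n → EuclideanSpace ℝ (Fin d)) :
    truncCov τ X = (n : ℝ)⁻¹ • ∑ i, truncOuter τ (X i) := by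
  simp only [truncCov, truncOuter, Finset.sum_filter]

/-- The cross term is `-2⟪x, y⟫²` or zero, so only the two squared norms count; the triangle
inequality would give `4 * τ ^ 2`. -/
theorem frob_truncOuter_sub_sq_le (τ : ℝ) (x y : EuclideanSpace ℝ (Fin d)) :
    frob (truncOuter τ x - truncOuter τ y) ^ 2 ≤ 2 * τ ^ 2 := by
  have h1 : ∀ z : EuclideanSpace ℝ (Fin d),
      frobInner (truncOuter τ z) (truncOuter τ z) ≤ τ ^ 2 := by
    intro z
    unfold truncOuter
    split_ifs with h
    · rw [frobInner_vecMulVec_vecMulVec, real_inner_self_eq_norm_sq]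
      exact pow_le_pow_left₀ (by positivity) h 2
    · simp only [frobInner, Matrix.zero_apply, mul_zero, Finset.sum_const_zero]
      positivity
  have h2 : 0 ≤ frobInner (truncOuter τ x) (truncOuter τ y) := by
    unfold truncOuter
    split_ifs
    · rw [frobInner_vecMulVec_vecMulVec]; positivity
    all_goals simp [frobInner]
  rw [frob_sq, frobInner_sub_left, frobInner_sub_right, frobInner_sub_right,
    frobInner_comm (truncOuter τ y) (truncOuter τ x)]
  linarith [h1 x, h1 y]

/-- The sensitivity of the truncated covariance. -/
theorem frob_truncCov_sub_sq_le (τ : ℝ) {X X' : Fin n → EuclideanSpace ℝ (Fin d)}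
    (h : Neighboring X X') : frob (truncCov τ X - truncCov τ X') ^ 2 ≤ 2 * τ ^ 2 / n ^ 2 := by
  rw [truncCov_eq, truncCov_eq, ← smul_sub, ← Finset.sum_sub_distrib, frob_smul_sq, inv_pow,
    inv_mul_eq_div]
  gcongr
  by_cases hX : ∃ i, X i ≠ X' i
  · obtain ⟨i, hi⟩ := hX
    rw [Finset.sum_eq_single i]
    · exact frob_truncOuter_sub_sq_le _ _ _
    · intro j _ hj
      have : X j = X' j := by
        by_contra hne
        exact hj (h hne hi)
      rw [this, sub_self]
    · simp
  · push Not at hX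
    rw [Finset.sum_eq_zero fun i _ => by rw [hX i, sub_self], frob_sq]
    simp only [frobInner, Matrix.zero_apply, mul_zero, Finset.sum_const_zero]
    positivity

theorem isZCDP_weakPPC {cS cN : ℝ} (hcS : 0 < cS) (hcN : √2 * cS ≤ cN) {ρ κ : ℝ} (β K : ℝ)
    (hρ : 0 < ρ) (hκ : 0 < κ) :
    IsZCDP ρ (fun X : Fin n → EuclideanSpace ℝ (Fin d) => weakPPC cS cN ρ β κ K X) := by
  refine ⟨fun X => isProbabilityMeasure_weakPPC _ _ _ _ hκ _ _, fun X X' hXX' α hα => ?_⟩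
  set τ := threshold cS d n β κ with hτ
  set t := symEntries (truncCov_isHermitian τ X) with ht
  set t' := symEntries (truncCov_isHermitian τ X') with ht'
  set v := (noiseScale cN d n ρ β κ ^ 2).toNNReal with hv
  have hv' : (v : ℝ) = noiseScale cN d n ρ β κ ^ 2 := Real.coe_toNNReal _ (sq_nonneg _)
  have hc : 2 * cS ^ 2 ≤ cN ^ 2 := by
    have := pow_le_pow_left₀ (by positivity) hcN 2
    rwa [mul_pow, Real.sq_sqrt (by norm_num)] at this
  have hdist : ∑ s, (t s - t' s) ^ 2 ≤ 2 * v * ρ := by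
    calc ∑ s, (t s - t' s) ^ 2 ≤ ∑ i, ∑ j, (t s(i, j) - t' s(i, j)) ^ 2 :=
          sum_sym2_le fun s => sq_nonneg _
      _ = frob (truncCov τ X - truncCov τ X') ^ 2 := by
          rw [frob_sq]
          simp [frobInner, sq, t, t', symEntries]
      _ ≤ 2 * τ ^ 2 / n ^ 2 := frob_truncCov_sub_sq_le τ hXX'
      _ = 2 * cS ^ 2 * ((d * κ * Real.log (n / β)) ^ 2 / n ^ 2) := by
          rw [hτ, threshold]; ring
      _ ≤ 2 * cN ^ 2 * ((d * κ * Real.log (n / β)) ^ 2 / n ^ 2) := by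
          refine mul_le_mul_of_nonneg_right ?_ (by positivity)
          linarith [sq_nonneg cS]
      _ = 2 * v * ρ := by
          rw [hv', noiseScale, mul_pow cN, div_pow, mul_pow (n : ℝ), Real.sq_sqrt hρ.le]
          rcases Nat.eq_zero_or_pos n with rfl | hn
          · simp
          · field_simp
  simp only [weakPPC_eq_map_gaussian _ _ _ _ hκ]
  -- The noise may vanish, for instance when `log (n / β) = 0`. The sensitivity bound then forces
  -- the two means to coincide.
  rcases eq_or_ne v 0 with hv0 | hv0
  · have : t = t' := by
      rw [hv0] at hdist
      have h0 : ∑ s, (t s - t' s) ^ 2 = 0 :=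
        le_antisymm (by simpa using hdist) (Finset.sum_nonneg fun s _ => sq_nonneg _)
      ext s
      have := (Finset.sum_eq_zero_iff_of_nonneg fun s _ => sq_nonneg _).mp h0 s
        (Finset.mem_univ s)
      exact sub_eq_zero.mp (pow_eq_zero_iff (two_ne_zero)|>.mp this)
    change renyiDiv α (Measure.map _ (Measure.pi fun s => gaussianReal (t s) v))
      (Measure.map _ (Measure.pi fun s => gaussianReal (t' s) v)) ≤ _
    have : IsProbabilityMeasure ((Measure.pi fun s => gaussianReal (t' s) v).map
        fun g => output κ K (psdProj (symMat g))) := Measure.isProbabilityMeasure_map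
      ((measurable_output_psdProj hκ K).comp measurable_symMat).aemeasurable
    rw [‹t = t'›, renyiDiv_self]
    exact_mod_cast (by positivity : 0 ≤ ρ * α)
  · exact (renyiDiv_map_le hα _ _ ((measurable_output_psdProj hκ K).comp measurable_symMat)).trans
      (renyiDiv_pi_gaussianReal_le hv0 t t' hα hdist)

end Privacy

/-! ### The operator norm of the noise -/

section Noise

/-- The unit ball of a `d`-dimensional normed space has a `1/2`-net with at most `5 ^ d` points. -/
theorem exists_half_net (E : Type*) [NormedAddCommGroup E] [NormedSpace ℝ E]
    [FiniteDimensional ℝ E] :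
    ∃ S : Finset E, S.card ≤ 5 ^ Module.finrank ℝ E ∧ (∀ x ∈ S, ‖x‖ ≤ 1) ∧
      ∀ u : E, ‖u‖ ≤ 1 → ∃ x ∈ S, ‖u - x‖ ≤ 1 / 2 := by
  classical
  let Sep : Finset E → Prop := fun S => (∀ x ∈ S, ‖x‖ ≤ 1) ∧
    ∀ x ∈ S, ∀ y ∈ S, x ≠ y → 1 / 2 ≤ ‖x - y‖
  have hcard : ∀ S, Sep S → S.card ≤ 5 ^ Module.finrank ℝ E := by
    intro S hS
    -- Doubling turns a `1/2`-separated subset of the unit ball into a `1`-separated subset of the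
    -- ball of radius `2`, the setting of the `5 ^ dim` bound.
    have hinj : Function.Injective fun x : E => (2 : ℝ) • x := smul_right_injective E two_ne_zero
    rw [← Finset.card_image_of_injective S hinj]
    refine Besicovitch.card_le_of_separated _ ?_ ?_
    · simp only [Finset.forall_mem_image]
      intro x hx
      rw [norm_smul]
      have := hS.1 x hx
      norm_num
      linarith
    · simp only [Finset.forall_mem_image]
      intro x hx y hy hne
      have := hS.2 x hx y hy (fun h => hne (by rw [h]))
      rw [← smul_sub, norm_smul]
      norm_num
      linarith
  let C : Set ℕ := {k | ∃ S, Sep S ∧ S.card = k}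
  have hne : C.Nonempty := ⟨0, ∅, by simp [Sep], rfl⟩
  have hbdd : BddAbove C := ⟨5 ^ Module.finrank ℝ E, by rintro k ⟨S, hS, rfl⟩; exact hcard S hS⟩
  -- A separated set of maximal cardinality is a net: a point far from all of it could be added.
  obtain ⟨S, hS, hSk⟩ := Nat.sSup_mem hne hbdd
  refine ⟨S, hcard S hS, hS.1, fun u hu => ?_⟩
  by_contra! hfar
  have huS : u ∉ S := fun h => by
    have := hfar u h
    norm_num at this
  have hins : Sep (insert u S) := by
    refine ⟨?_, ?_⟩
    · simpa [hu] using hS.1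
    · intro x hx y hy hxy
      rcases Finset.mem_insert.mp hx with rfl | hx' <;> rcases Finset.mem_insert.mp hy with rfl | hy'
      · exact absurd rfl hxy
      · exact (hfar y hy').le
      · rw [norm_sub_rev]; exact (hfar x hx').le
      · exact hS.2 x hx' y hy' hxy
  have := le_csSup hbdd ⟨insert u S, hins, rfl⟩
  rw [Finset.card_insert_of_notMem huS, hSk] at this
  omega

/-- Testing a vector against the net costs a factor `2`. Replacing a unit vector by a net point
gives `‖T‖ ≤ 2t + ‖T‖ / 2`, a second factor `2`. -/
theorem opNorm_le_of_half_net {E : Type*} [NormedAddCommGroup E] [InnerProductSpace ℝ E]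
    {S : Finset E} (hS : ∀ u : E, ‖u‖ ≤ 1 → ∃ x ∈ S, ‖u - x‖ ≤ 1 / 2) {t : ℝ} (T : E →L[ℝ] E)
    (hT : ∀ x ∈ S, ∀ y ∈ S, inner ℝ x (T y) ≤ t) : ‖T‖ ≤ 4 * t := by
  have h1 : ∀ w : E, ∃ x ∈ S, ‖w‖ ≤ 2 * inner ℝ x w := by
    intro w
    rcases eq_or_ne w 0 with rfl | hw
    · obtain ⟨x, hx, -⟩ := hS 0 (by simp)
      exact ⟨x, hx, by simp⟩
    · have hw' : 0 < ‖w‖ := norm_pos_iff.mpr hw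
      obtain ⟨x, hx, hxu⟩ := hS (‖w‖⁻¹ • w) (by rw [norm_smul]; simp [hw'.ne'])
      refine ⟨x, hx, ?_⟩
      have h2 : inner ℝ (‖w‖⁻¹ • w) w = ‖w‖ := by
        rw [inner_smul_left, real_inner_self_eq_norm_sq]
        simp only [conj_trivial]
        field_simp
      have h3 : inner ℝ (‖w‖⁻¹ • w - x) w ≤ 1 / 2 * ‖w‖ :=
        (real_inner_le_norm _ _).trans (by gcongr)
      rw [inner_sub_left, h2] at h3
      linarith
  have h2 : ∀ y ∈ S, ‖T y‖ ≤ 2 * t := by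
    intro y hy
    obtain ⟨x, hx, h⟩ := h1 (T y)
    linarith [hT x hx y hy]
  have ht : 0 ≤ 2 * t := by
    obtain ⟨y, hy, -⟩ := hS 0 (by simp)
    exact (norm_nonneg _).trans (h2 y hy)
  have h3 : ‖T‖ ≤ 2 * t + ‖T‖ / 2 := by
    refine ContinuousLinearMap.opNorm_le_of_unit_norm (by positivity) fun u hu => ?_
    obtain ⟨y, hy, huy⟩ := hS u hu.le
    calc ‖T u‖ = ‖T y + T (u - y)‖ := by rw [← map_add]; simp
      _ ≤ ‖T y‖ + ‖T‖ * ‖u - y‖ := (norm_add_le _ _).trans (by gcongr; exact T.le_opNorm _)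
      _ ≤ 2 * t + ‖T‖ * (1 / 2) := by gcongr; exact h2 y hy
      _ = _ := by ring
  linarith

variable {d : ℕ}

open Classical in
/-- The coefficient of the `s`-entry of a symmetric matrix `M` in `⟪x, M y⟫`. -/
noncomputable def bilinCoeff (x y : EuclideanSpace ℝ (Fin d)) (s : Sym2 (Fin d)) : ℝ :=
  ∑ p : Fin d × Fin d with s(p.1, p.2) = s, x p.1 * y p.2

theorem inner_symMat (g : Sym2 (Fin d) → ℝ) (x y : EuclideanSpace ℝ (Fin d)) :
    inner ℝ x (Matrix.toEuclideanCLM (𝕜 := ℝ) (symMat g) y) = ∑ s, bilinCoeff x y s * g s := by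
  classical
  rw [Matrix.inner_toEuclideanCLM]
  simp only [dotProduct, Matrix.mulVec, symMat, Matrix.of_apply, Finset.mul_sum]
  rw [← Fintype.sum_prod_type' (fun i j => x i * (g s(i, j) * y j)),
    ← Finset.sum_fiberwise (Finset.univ : Finset (Fin d × Fin d)) (fun p => s(p.1, p.2))]
  refine Finset.sum_congr rfl fun s _ => ?_
  rw [bilinCoeff, Finset.sum_mul]
  refine Finset.sum_congr (by congr) fun p hp => ?_
  rw [(Finset.mem_filter.mp hp).2]
  ring

/-- At most two ordered pairs lie over an unordered one, so Cauchy–Schwarz on each fibre costs a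
factor `2`. -/
theorem sum_bilinCoeff_sq_le (x y : EuclideanSpace ℝ (Fin d)) :
    ∑ s, bilinCoeff x y s ^ 2 ≤ 2 * (‖x‖ ^ 2 * ‖y‖ ^ 2) := by
  classical
  have h1 : ∀ s, bilinCoeff x y s ^ 2 ≤
      2 * ∑ p : Fin d × Fin d with s(p.1, p.2) = s, (x p.1 * y p.2) ^ 2 := by
    intro s
    have hc : (Finset.univ.filter fun p : Fin d × Fin d => s(p.1, p.2) = s).card ≤ 2 := by
      induction s using Sym2.ind with
      | _ i j =>
        refine (Finset.card_le_card (t := {(i, j), (j, i)}) fun p hp => ?_).trans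
          Finset.card_le_two
        have := (Finset.mem_filter.mp hp).2
        rw [Sym2.eq_iff] at this
        rcases this with ⟨h, h'⟩ | ⟨h, h'⟩ <;> simp [Prod.ext_iff, h, h']
    have h2 := sq_sum_le_card_mul_sum_sq
      (s := Finset.univ.filter fun p : Fin d × Fin d => s(p.1, p.2) = s)
      (f := fun p => x p.1 * y p.2)
    have h3 : bilinCoeff x y s = ∑ p : Fin d × Fin d with s(p.1, p.2) = s, x p.1 * y p.2 :=
      Finset.sum_congr (by congr) fun _ _ => rfl
    rw [h3]
    refine h2.trans ?_
    gcongr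
    exact_mod_cast hc
  calc ∑ s, bilinCoeff x y s ^ 2
      ≤ ∑ s, 2 * ∑ p : Fin d × Fin d with s(p.1, p.2) = s, (x p.1 * y p.2) ^ 2 :=
        Finset.sum_le_sum fun s _ => h1 s
    _ = 2 * ∑ p : Fin d × Fin d, (x p.1 * y p.2) ^ 2 := by
        rw [← Finset.mul_sum, Finset.sum_fiberwise]
    _ = 2 * (‖x‖ ^ 2 * ‖y‖ ^ 2) := by
        rw [EuclideanSpace.real_norm_sq_eq, EuclideanSpace.real_norm_sq_eq, Finset.sum_mul_sum,
          ← Fintype.sum_prod_type' (fun i j => x i ^ 2 * y j ^ 2)]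
        simp only [mul_pow]

theorem lintegral_exp_mul_gaussianReal (v : ℝ≥0) (a : ℝ) :
    ∫⁻ x, ENNReal.ofReal (Real.exp (a * x)) ∂(gaussianReal 0 v) =
      ENNReal.ofReal (Real.exp (v * a ^ 2 / 2)) := by
  rw [← ofReal_integral_eq_lintegral_ofReal (integrable_exp_mul_gaussianReal _)
    (ae_of_all _ fun x => by positivity)]
  have h2 := congrFun (mgf_id_gaussianReal (μ := 0) (v := v)) a
  simp only [mgf, id] at h2
  rw [h2]
  simp

/-- Gaussian tail bound for linear combinations of independent Gaussians. -/
theorem measure_lt_sum_mul_le {ι : Type*} [Fintype ι] {v : ℝ≥0} (hv : v ≠ 0) {a : ι → ℝ}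
    (ha : ∑ i, a i ^ 2 ≤ 2) {t : ℝ} (ht : 0 < t) :
    (Measure.pi fun _ : ι => gaussianReal 0 v) {g | t < ∑ i, a i * g i} ≤
      ENNReal.ofReal (Real.exp (-(t ^ 2 / (4 * v)))) := by
  have hv' : 0 < (v : ℝ) := by exact_mod_cast pos_iff_ne_zero.mpr hv
  -- The Chernoff parameter minimising `v l² - l t`; the minimum is `-t² / (4v)`.
  set l : ℝ := t / (2 * v) with hl
  have hl0 : 0 < l := by positivity
  set μ := Measure.pi fun _ : ι => gaussianReal 0 v
  have hm : Measurable fun g : ι → ℝ => ENNReal.ofReal (Real.exp (l * ∑ i, a i * g i)) := by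
    fun_prop
  have h1 : ∫⁻ g, ENNReal.ofReal (Real.exp (l * ∑ i, a i * g i)) ∂μ ≤
      ENNReal.ofReal (Real.exp (v * l ^ 2)) := by
    have h2 : ∀ g : ι → ℝ, ENNReal.ofReal (Real.exp (l * ∑ i, a i * g i)) =
        ∏ i, ENNReal.ofReal (Real.exp ((l * a i) * g i)) := by
      intro g
      rw [← ENNReal.ofReal_prod_of_nonneg fun i _ => (Real.exp_pos _).le, ← Real.exp_sum,
        Finset.mul_sum]
      simp only [mul_assoc]
    rw [lintegral_congr h2, lintegral_pi_prod
      (f := fun i x => ENNReal.ofReal (Real.exp ((l * a i) * x))) fun i => by fun_prop]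
    simp only [lintegral_exp_mul_gaussianReal]
    rw [← ENNReal.ofReal_prod_of_nonneg fun i _ => (Real.exp_pos _).le, ← Real.exp_sum]
    refine ENNReal.ofReal_le_ofReal (Real.exp_le_exp.mpr ?_)
    calc ∑ i, v * (l * a i) ^ 2 / 2 = v * l ^ 2 / 2 * ∑ i, a i ^ 2 := by
          rw [Finset.mul_sum]
          exact Finset.sum_congr rfl fun i _ => by ring
      _ ≤ v * l ^ 2 / 2 * 2 := by gcongr
      _ = _ := by ring
  have h3 := mul_meas_ge_le_lintegral (μ := μ) hm (ENNReal.ofReal (Real.exp (l * t)))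
  have h4 : μ {g | t < ∑ i, a i * g i} ≤ μ {g | ENNReal.ofReal (Real.exp (l * t)) ≤
      ENNReal.ofReal (Real.exp (l * ∑ i, a i * g i))} :=
    measure_mono fun g (hg : t < _) => ENNReal.ofReal_le_ofReal
      (Real.exp_le_exp.mpr (mul_le_mul_of_nonneg_left hg.le hl0.le))
  have h5 : ENNReal.ofReal (Real.exp (-(t ^ 2 / (4 * v)))) =
      ENNReal.ofReal (Real.exp (v * l ^ 2)) / ENNReal.ofReal (Real.exp (l * t)) := by
    rw [← ENNReal.ofReal_div_of_pos (Real.exp_pos _), ← Real.exp_sub]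
    congr 2
    rw [hl]
    field_simp
    ring
  rw [h5, ENNReal.le_div_iff_mul_le (Or.inl (by simp [Real.exp_pos])) (Or.inl (by simp)),
    mul_comm]
  exact (mul_le_mul_right h4 _).trans (h3.trans h1)

/-- Union bound over the at most `25 ^ d` pairs of net points. -/
theorem measure_lt_norm_symMat_le {v : ℝ≥0} (hv : v ≠ 0) {t : ℝ} (ht : 0 < t) :
    (Measure.pi fun _ : Sym2 (Fin d) => gaussianReal 0 v)
        {g | 4 * t < ‖Matrix.toEuclideanCLM (𝕜 := ℝ) (symMat g)‖} ≤
      ENNReal.ofReal (25 ^ d * Real.exp (-(t ^ 2 / (4 * v)))) := by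
  obtain ⟨S, hcard, hnorm, hnet⟩ := exists_half_net (EuclideanSpace ℝ (Fin d))
  rw [finrank_euclideanSpace_fin] at hcard
  set μ := Measure.pi fun _ : Sym2 (Fin d) => gaussianReal 0 v
  have hsub : {g | 4 * t < ‖Matrix.toEuclideanCLM (𝕜 := ℝ) (symMat g)‖} ⊆
      ⋃ p ∈ S ×ˢ S, {g : Sym2 (Fin d) → ℝ | t < ∑ s, bilinCoeff p.1 p.2 s * g s} := by
    intro g hg
    by_contra hcon
    simp only [Set.mem_iUnion, not_exists, Set.mem_ofPred_eq, not_lt, Finset.mem_product] at hcon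
    refine (not_lt.mpr (opNorm_le_of_half_net hnet _ fun x hx y hy => ?_)) hg
    rw [inner_symMat]
    exact hcon (x, y) ⟨hx, hy⟩
  calc μ _ ≤ _ := measure_mono hsub
    _ ≤ ∑ p ∈ S ×ˢ S, μ {g : Sym2 (Fin d) → ℝ | t < ∑ s, bilinCoeff p.1 p.2 s * g s} :=
        measure_biUnion_finset_le _ _
    _ ≤ ∑ p ∈ S ×ˢ S, ENNReal.ofReal (Real.exp (-(t ^ 2 / (4 * v)))) := by
        refine Finset.sum_le_sum fun p hp => measure_lt_sum_mul_le hv ?_ ht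
        obtain ⟨h1, h2⟩ := Finset.mem_product.mp hp
        refine (sum_bilinCoeff_sq_le _ _).trans ?_
        have := mul_le_one₀ (pow_le_one₀ (norm_nonneg _) (hnorm _ h1) : ‖p.1‖ ^ 2 ≤ 1)
          (by positivity) (pow_le_one₀ (norm_nonneg _) (hnorm _ h2) : ‖p.2‖ ^ 2 ≤ 1)
        linarith
    _ ≤ (25 ^ d : ℕ) * ENNReal.ofReal (Real.exp (-(t ^ 2 / (4 * v)))) := by
        rw [Finset.sum_const, nsmul_eq_mul]
        gcongr
        rw [Finset.card_product]
        calc S.card * S.card ≤ 5 ^ d * 5 ^ d := Nat.mul_le_mul hcard hcard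
          _ = 25 ^ d := by rw [← mul_pow]; norm_num
    _ = _ := by
        rw [ENNReal.ofReal_mul (by positivity), ENNReal.ofReal_pow (by norm_num)]
        simp

/-- With high probability, the noise is of order `√(v d) log (1/β)` in operator norm. -/
theorem ofReal_le_measure_norm_symMat_le (hd : 1 ≤ d) {v : ℝ≥0} (hv : v ≠ 0) {β : ℝ} (hβ : 0 < β)
    (hL : 1 ≤ Real.log (1 / β)) :
    ENNReal.ofReal (1 - β) ≤ (Measure.pi fun _ : Sym2 (Fin d) => gaussianReal 0 v)
      {g | ‖Matrix.toEuclideanCLM (𝕜 := ℝ) (symMat g)‖ ≤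
        20 * (√v * √d * Real.log (1 / β))} := by
  have hv' : 0 < (v : ℝ) := by exact_mod_cast pos_iff_ne_zero.mpr hv
  have hd' : (1 : ℝ) ≤ d := by exact_mod_cast hd
  set L := Real.log (1 / β) with hLdef
  set μ := Measure.pi fun _ : Sym2 (Fin d) => gaussianReal 0 v
  -- With this `t` the tail exponent is `(25/4) d L²`. As `d, L ≥ 1`, it exceeds `5d + L`, which
  -- covers the entropy `log (25 ^ d) ≤ 5d` and leaves `exp (-L) = β`.
  have ht : 0 < 5 * (√v * √d * L) := by positivity
  have h1 := measure_lt_norm_symMat_le (d := d) hv ht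
  have h2 : 25 ^ d * Real.exp (-((5 * (√v * √d * L)) ^ 2 / (4 * v))) ≤ β := by
    have e1 : (5 * (√v * √d * L)) ^ 2 / (4 * v) = 25 / 4 * (d * L ^ 2) := by
      rw [mul_pow, mul_pow, mul_pow, Real.sq_sqrt hv'.le, Real.sq_sqrt (by positivity)]
      field_simp
      norm_num
    have e2 : (25 : ℝ) ≤ Real.exp 5 := by
      have : (2.7 : ℝ) ^ 5 ≤ Real.exp 1 ^ 5 :=
        pow_le_pow_left₀ (by norm_num) (by linarith [Real.exp_one_gt_d9]) 5
      rw [← Real.exp_nat_mul] at this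
      norm_num at this ⊢
      linarith
    have e3 : β = Real.exp (-L) := by
      rw [hLdef, one_div, Real.log_inv, neg_neg, Real.exp_log hβ]
    have e4 : (25 : ℝ) ^ d ≤ Real.exp (5 * d) := by
      rw [mul_comm, Real.exp_nat_mul]
      exact pow_le_pow_left₀ (by norm_num) e2 d
    calc 25 ^ d * Real.exp (-((5 * (√v * √d * L)) ^ 2 / (4 * v)))
        ≤ Real.exp (5 * d) * Real.exp (-(25 / 4 * (d * L ^ 2))) := by rw [e1]; gcongr
      _ = Real.exp (5 * d - 25 / 4 * (d * L ^ 2)) := by rw [← Real.exp_add]; ring_nf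
      _ ≤ Real.exp (-L) := by
          refine Real.exp_le_exp.mpr ?_
          have hLL : L ≤ L ^ 2 := by nlinarith
          have f1 : (d : ℝ) ≤ d * L ^ 2 := by nlinarith
          have f2 : L ≤ d * L ^ 2 := by nlinarith
          nlinarith
      _ = β := e3.symm
  have hset : {g : Sym2 (Fin d) → ℝ | ‖Matrix.toEuclideanCLM (𝕜 := ℝ) (symMat g)‖ ≤ 20 * (√v * √d * L)} =
      {g : Sym2 (Fin d) → ℝ |
        4 * (5 * (√v * √d * L)) < ‖Matrix.toEuclideanCLM (𝕜 := ℝ) (symMat g)‖}ᶜ := by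
    ext g
    simp only [Set.mem_ofPred_eq, Set.mem_compl_iff, not_lt]
    rw [show 4 * (5 * (√v * √d * L)) = 20 * (√v * √d * L) by ring]
  rw [hset, ENNReal.ofReal_sub _ hβ.le, ENNReal.ofReal_one]
  calc 1 - ENNReal.ofReal β
      ≤ 1 - μ {g | 4 * (5 * (√v * √d * L)) < ‖Matrix.toEuclideanCLM (𝕜 := ℝ) (symMat g)‖} :=
        tsub_le_tsub_left (h1.trans (ENNReal.ofReal_le_ofReal h2)) _
    _ ≤ _ := by
        rw [tsub_le_iff_left, ← measure_univ (μ := μ), ← Set.union_compl_self]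
        exact measure_union_le _ _

end Noise

/-! ### Quadratic forms and the deterministic analysis -/

section Deterministic

variable {d n : ℕ}

/-- The bilinear form of a matrix. -/
noncomputable def quad (M : Matrix (Fin d) (Fin d) ℝ) (x y : EuclideanSpace ℝ (Fin d)) : ℝ :=
  inner ℝ x (Matrix.toEuclideanCLM (𝕜 := ℝ) M y)

theorem quad_add (M N : Matrix (Fin d) (Fin d) ℝ) (x y : EuclideanSpace ℝ (Fin d)) :
    quad (M + N) x y = quad M x y + quad N x y := by
  simp [quad, inner_add_right]

theorem quad_sub (M N : Matrix (Fin d) (Fin d) ℝ) (x y : EuclideanSpace ℝ (Fin d)) :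
    quad (M - N) x y = quad M x y - quad N x y := by
  simp [quad, inner_sub_right]

theorem quad_smul (c : ℝ) (M : Matrix (Fin d) (Fin d) ℝ) (x y : EuclideanSpace ℝ (Fin d)) :
    quad (c • M) x y = c * quad M x y := by
  rw [quad, map_smul, smul_apply, inner_smul_right]
  rfl

theorem quad_smul_one (c : ℝ) (x : EuclideanSpace ℝ (Fin d)) : quad (c • 1) x x = c * ‖x‖ ^ 2 := by
  simp [quad, inner_smul_right]

theorem quad_comm {M : Matrix (Fin d) (Fin d) ℝ} (hM : M.IsHermitian)
    (x y : EuclideanSpace ℝ (Fin d)) : quad M x y = quad M y x := by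
  rw [quad, ← inner_toEuclideanCLM_comm hM, real_inner_comm]; rfl

theorem quad_smul_add {M : Matrix (Fin d) (Fin d) ℝ} (hM : M.IsHermitian) (k : ℝ)
    (x y : EuclideanSpace ℝ (Fin d)) :
    quad M (k • x + y) (k • x + y) = k ^ 2 * quad M x x + 2 * k * quad M x y + quad M y y := by
  have h := quad_comm hM x y
  simp only [quad, map_add, map_smul, inner_add_left, inner_add_right, inner_smul_left,
    inner_smul_right, conj_trivial] at *
  rw [← h]
  ring

theorem abs_quad_le (M : Matrix (Fin d) (Fin d) ℝ) (x y : EuclideanSpace ℝ (Fin d)) :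
    |quad M x y| ≤ ‖Matrix.toEuclideanCLM (𝕜 := ℝ) M‖ * (‖x‖ * ‖y‖) := by
  refine (abs_real_inner_le_norm _ _).trans ?_
  calc ‖x‖ * ‖Matrix.toEuclideanCLM (𝕜 := ℝ) M y‖
      ≤ ‖x‖ * (‖Matrix.toEuclideanCLM (𝕜 := ℝ) M‖ * ‖y‖) := by
        gcongr; exact ContinuousLinearMap.le_opNorm _ _
    _ = _ := by ring

theorem quad_mul_mul {A : Matrix (Fin d) (Fin d) ℝ} (hA : A.IsHermitian)
    (S : Matrix (Fin d) (Fin d) ℝ) (x y : EuclideanSpace ℝ (Fin d)) :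
    quad (A * S * A) x y =
      quad S (Matrix.toEuclideanCLM (𝕜 := ℝ) A x) (Matrix.toEuclideanCLM (𝕜 := ℝ) A y) := by
  simp only [quad, map_mul, mul_apply_eq_comp]
  rw [inner_toEuclideanCLM_comm hA]

theorem quad_le_of_le {A B : Matrix (Fin d) (Fin d) ℝ} (h : A ≤ B)
    (x : EuclideanSpace ℝ (Fin d)) : quad A x x ≤ quad B x x := by
  have := (Matrix.le_iff.mp h).dotProduct_mulVec_nonneg x.ofLp
  rw [star_trivial, ← Matrix.inner_toEuclideanCLM] at this
  have h2 := quad_sub B A x x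
  unfold quad at *
  linarith

theorem le_of_quad_le {A B : Matrix (Fin d) (Fin d) ℝ} (hA : A.IsHermitian) (hB : B.IsHermitian)
    (h : ∀ x, quad A x x ≤ quad B x x) : A ≤ B := by
  refine Matrix.le_iff.mpr (Matrix.PosSemidef.of_dotProduct_mulVec_nonneg (hB.sub hA) fun x => ?_)
  have h1 := Matrix.inner_toEuclideanCLM (B - A) (WithLp.toLp 2 x) (WithLp.toLp 2 x)
  have h2 := quad_sub B A (WithLp.toLp 2 x) (WithLp.toLp 2 x)
  have h3 := h (WithLp.toLp 2 x)
  rw [quad, h1] at h2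
  rw [star_trivial]
  linarith

theorem quad_eq_sum_eigenvalues {M : Matrix (Fin d) (Fin d) ℝ} (hM : M.IsHermitian)
    (x y : EuclideanSpace ℝ (Fin d)) :
    quad M x y = ∑ i, hM.eigenvalues i *
      (inner ℝ (hM.eigenvectorBasis i) x * inner ℝ (hM.eigenvectorBasis i) y) := by
  rw [quad, ← hM.eigenvectorBasis.sum_inner_mul_inner]
  refine Finset.sum_congr rfl fun i _ => ?_
  rw [← inner_toEuclideanCLM_comm hM, toEuclideanCLM_eigenvectorBasis, inner_smul_left,
    real_inner_comm]
  simp only [conj_trivial]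
  ring

theorem norm_sq_eq_sum_eigenvectorBasis {M : Matrix (Fin d) (Fin d) ℝ} (hM : M.IsHermitian)
    (x : EuclideanSpace ℝ (Fin d)) :
    ‖x‖ ^ 2 = ∑ i, inner ℝ (hM.eigenvectorBasis i) x * inner ℝ (hM.eigenvectorBasis i) x := by
  rw [← real_inner_self_eq_norm_sq, ← hM.eigenvectorBasis.sum_inner_mul_inner]
  exact Finset.sum_congr rfl fun i _ => by rw [real_inner_comm]

theorem inner_eigenvectorBasis_eq_zero_of_mem {κ : ℝ} {M : Matrix (Fin d) (Fin d) ℝ}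
    (hM : M.IsHermitian) {x : EuclideanSpace ℝ (Fin d)} (hx : x ∈ topSpace κ M) {i : Fin d}
    (hi : hM.eigenvalues i < κ / 2) : inner ℝ (hM.eigenvectorBasis i) x = 0 := by
  rw [real_inner_comm]
  exact (mem_topSpace_orthogonal_of_apply_eq hM hi (toEuclideanCLM_eigenvectorBasis hM i)) x hx

theorem inner_eigenvectorBasis_eq_zero_of_mem_orthogonal {κ : ℝ} {M : Matrix (Fin d) (Fin d) ℝ}
    (hM : M.IsHermitian) {x : EuclideanSpace ℝ (Fin d)} (hx : x ∈ (topSpace κ M)ᗮ) {i : Fin d}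
    (hi : κ / 2 ≤ hM.eigenvalues i) : inner ℝ (hM.eigenvectorBasis i) x = 0 :=
  hx _ (mem_topSpace_of_apply_eq hi (toEuclideanCLM_eigenvectorBasis hM i))

theorem le_quad_of_mem_topSpace {κ : ℝ} {M : Matrix (Fin d) (Fin d) ℝ} (hM : M.IsHermitian)
    {x : EuclideanSpace ℝ (Fin d)} (hx : x ∈ topSpace κ M) : κ / 2 * ‖x‖ ^ 2 ≤ quad M x x := by
  rw [quad_eq_sum_eigenvalues hM, norm_sq_eq_sum_eigenvectorBasis hM, Finset.mul_sum]
  refine Finset.sum_le_sum fun i _ => ?_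
  rcases lt_or_ge (hM.eigenvalues i) (κ / 2) with h | h
  · simp [inner_eigenvectorBasis_eq_zero_of_mem hM hx h]
  · exact mul_le_mul_of_nonneg_right h (mul_self_nonneg _)

theorem quad_le_of_mem_topSpace_orthogonal {κ : ℝ} {M : Matrix (Fin d) (Fin d) ℝ}
    (hM : M.IsHermitian) {x : EuclideanSpace ℝ (Fin d)} (hx : x ∈ (topSpace κ M)ᗮ) :
    quad M x x ≤ κ / 2 * ‖x‖ ^ 2 := by
  rw [quad_eq_sum_eigenvalues hM, norm_sq_eq_sum_eigenvectorBasis hM, Finset.mul_sum]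
  refine Finset.sum_le_sum fun i _ => ?_
  rcases lt_or_ge (hM.eigenvalues i) (κ / 2) with h | h
  · exact mul_le_mul_of_nonneg_right h.le (mul_self_nonneg _)
  · simp [inner_eigenvectorBasis_eq_zero_of_mem_orthogonal hM hx h]

/-- In an eigenbasis the two vectors have disjoint supports. -/
theorem quad_eq_zero_of_mem_topSpace {κ : ℝ} {M : Matrix (Fin d) (Fin d) ℝ} (hM : M.IsHermitian)
    {x y : EuclideanSpace ℝ (Fin d)} (hx : x ∈ topSpace κ M) (hy : y ∈ (topSpace κ M)ᗮ) :
    quad M x y = 0 := by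
  rw [quad_eq_sum_eigenvalues hM]
  refine Finset.sum_eq_zero fun i _ => ?_
  rcases lt_or_ge (hM.eigenvalues i) (κ / 2) with h | h
  · simp [inner_eigenvectorBasis_eq_zero_of_mem hM hx h]
  · simp [inner_eigenvectorBasis_eq_zero_of_mem_orthogonal hM hy h]

theorem projMatrix_isHermitian (V : Submodule ℝ (EuclideanSpace ℝ (Fin d))) :
    (projMatrix V).IsHermitian := by
  refine Matrix.isSymmetric_toEuclideanLin_iff.mp fun x y => ?_
  change inner ℝ (Matrix.toEuclideanCLM (𝕜 := ℝ) (projMatrix V) x) y =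
    inner ℝ x (Matrix.toEuclideanCLM (𝕜 := ℝ) (projMatrix V) y)
  rw [toEuclideanCLM_projMatrix]
  exact Submodule.inner_starProjection_left_eq_right _ _ _

theorem precond_isHermitian (K : ℝ) (V : Submodule ℝ (EuclideanSpace ℝ (Fin d))) :
    (precond K V).IsHermitian :=
  ((projMatrix_isHermitian V).smul (IsSelfAdjoint.all _)).add (projMatrix_isHermitian _)

theorem toEuclideanCLM_precond (K : ℝ) (V : Submodule ℝ (EuclideanSpace ℝ (Fin d)))
    (x : EuclideanSpace ℝ (Fin d)) :
    Matrix.toEuclideanCLM (𝕜 := ℝ) (precond K V) x =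
      (1 / √K) • V.starProjection x + Vᗮ.starProjection x := by
  rw [precond, map_add, map_smul, toEuclideanCLM_projMatrix, toEuclideanCLM_projMatrix]
  rfl

/-- What regularity and a bound on the noise give: `S` is the covariance, `E` its empirical
version, `N` the noise. -/
structure NoisyCov (p φ κ : ℝ) (S E N : Matrix (Fin d) (Fin d) ℝ) : Prop where
  p_nonneg : 0 ≤ p
  φ_nonneg : 0 ≤ φ
  κ_pos : 0 < κ
  S_herm : S.IsHermitian
  E_herm : E.IsHermitian
  N_herm : N.IsHermitian
  one_le : ∀ x, ‖x‖ ^ 2 ≤ quad S x x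
  le_κ : ∀ x, quad S x x ≤ κ * ‖x‖ ^ 2
  E_nonneg : ∀ x, 0 ≤ quad E x x
  le_E : ∀ x, (1 - p) * quad S x x ≤ quad E x x
  E_le : ∀ x, quad E x x ≤ (1 + p) * quad S x x
  norm_N : ‖Matrix.toEuclideanCLM (𝕜 := ℝ) N‖ ≤ κ * φ / 2

namespace NoisyCov

variable {p φ κ K : ℝ} {S E N : Matrix (Fin d) (Fin d) ℝ}

theorem abs_quad_noise_le (h : NoisyCov p φ κ S E N) (x y : EuclideanSpace ℝ (Fin d)) :
    |quad N x y| ≤ κ * φ / 2 * (‖x‖ * ‖y‖) :=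
  (abs_quad_le N x y).trans (mul_le_mul_of_nonneg_right h.norm_N (by positivity))

theorem norm_smul_add_sq {a b : EuclideanSpace ℝ (Fin d)} (hab : inner ℝ a b = 0) (k : ℝ) :
    ‖k • a + b‖ ^ 2 = k ^ 2 * ‖a‖ ^ 2 + ‖b‖ ^ 2 := by
  rw [norm_add_sq_real, inner_smul_left, hab, norm_smul, mul_pow, Real.norm_eq_abs, sq_abs]
  ring

/-- Write `E = (E + N) - N` at `w`. The form of `E + N` splits along `V` and `Vᗮ`; the noise enters
once through `a` and once through `w`, each time with `κφ/2`, which adds up to `κφ`. -/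
theorem quad_le (h : NoisyCov p φ κ S E N) (hK : 0 < K) {a b : EuclideanSpace ℝ (Fin d)}
    (ha : a ∈ topSpace κ (E + N)) (hb : b ∈ (topSpace κ (E + N))ᗮ) :
    quad S ((1 / √K) • a + b) ((1 / √K) • a + b) ≤
      (1 + 4 * p) * (κ * (max (1 / K) (1 / 2) + φ)) * (‖a‖ ^ 2 + ‖b‖ ^ 2) := by
  have hκ := h.κ_pos
  have hp := h.p_nonneg
  have hφ := h.φ_nonneg
  have hM : (E + N).IsHermitian := h.E_herm.add h.N_herm
  set k := 1 / √K with hk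
  have hk2 : k ^ 2 = 1 / K := by rw [hk, div_pow, Real.sq_sqrt hK.le, one_pow]
  set w := k • a + b with hw
  have hwn : ‖w‖ ^ 2 = 1 / K * ‖a‖ ^ 2 + ‖b‖ ^ 2 := by
    rw [hw, norm_smul_add_sq (hb a ha), hk2]
  set m := max (1 / K) (1 / 2) with hm
  have hm1 : 1 / K ≤ m := le_max_left _ _
  have hm2 : 1 / 2 ≤ m := le_max_right _ _
  have hA : 0 ≤ ‖a‖ ^ 2 := by positivity
  have hB : 0 ≤ ‖b‖ ^ 2 := by positivity
  set A2 := ‖a‖ ^ 2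
  set B2 := ‖b‖ ^ 2
  have hSw := h.le_κ w
  -- For `K ≤ 1`, and below for `p > 1/2`, the claimed bound is so weak that `S ≤ κ` suffices.
  rcases le_or_gt K 1 with hK1 | hK1
  · have h1 : 1 ≤ 1 / K := by rw [le_div_iff₀ hK]; linarith
    have h2 : ‖w‖ ^ 2 ≤ m * (A2 + B2) := by rw [hwn]; nlinarith
    calc quad S w w ≤ κ * (m * (A2 + B2)) := hSw.trans (by gcongr)
      _ = 1 * (κ * (m + 0)) * (A2 + B2) := by ring
      _ ≤ _ := by gcongr; linarith
  have h1 : 1 / K ≤ 1 := by rw [div_le_iff₀ hK]; linarith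
  have hw1 : ‖w‖ ^ 2 ≤ A2 + B2 := by rw [hwn]; nlinarith
  rcases lt_or_ge (1 / 2) p with hp2 | hp2
  · calc quad S w w ≤ κ * (A2 + B2) := hSw.trans (by gcongr)
      _ ≤ 3 * (κ * (1 / 2 + 0)) * (A2 + B2) := by nlinarith [mul_nonneg hκ.le (add_nonneg hA hB)]
      _ ≤ _ := by gcongr; linarith
  · have hE : (1 - p) * quad S w w ≤ (1 + p) * (κ * (m + φ)) * (A2 + B2) := by
      have e1 : quad E w w = quad (E + N) w w - quad N w w := by rw [quad_add]; ring
      have e2 : quad (E + N) w w = 1 / K * quad (E + N) a a + quad (E + N) b b := by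
        rw [hw, quad_smul_add hM, quad_eq_zero_of_mem_topSpace hM ha hb, hk2]; ring
      have e3 : quad (E + N) a a ≤ (1 + p) * (κ * A2) + κ * φ / 2 * A2 := by
        have f1 := (h.E_le a).trans (mul_le_mul_of_nonneg_left (h.le_κ a) (by linarith))
        have f2 := (le_abs_self _).trans (h.abs_quad_noise_le a a)
        rw [← sq] at f2
        rw [quad_add]
        linarith
      have e4 := quad_le_of_mem_topSpace_orthogonal hM hb
      have e5 : -quad N w w ≤ κ * φ / 2 * (A2 + B2) := by
        have f2 := (neg_le_abs _).trans (h.abs_quad_noise_le w w)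
        rw [← sq] at f2
        exact f2.trans (by gcongr)
      have hK0 : 0 < 1 / K := by positivity
      have e6 : 1 / K * quad (E + N) a a ≤ m * ((1 + p) * (κ * A2)) + κ * φ / 2 * A2 := by
        calc 1 / K * quad (E + N) a a ≤ 1 / K * ((1 + p) * (κ * A2) + κ * φ / 2 * A2) := by gcongr
          _ = 1 / K * ((1 + p) * (κ * A2)) + 1 / K * (κ * φ / 2 * A2) := by ring
          _ ≤ m * ((1 + p) * (κ * A2)) + 1 * (κ * φ / 2 * A2) := by gcongr
          _ = _ := by ring
      have e7 : κ / 2 * B2 ≤ m * ((1 + p) * (κ * B2)) := by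
        have : 1 / 2 ≤ m * (1 + p) := by nlinarith
        nlinarith [mul_nonneg hκ.le hB]
      have e8 : 0 ≤ κ * φ / 2 * B2 := by positivity
      have e9 : 0 ≤ p * (κ * φ * (A2 + B2)) := by positivity
      have := h.le_E w
      nlinarith
    -- True exactly because `0 ≤ p ≤ 1/2`; this is where `ψ = 4p` comes from.
    have hc : (1 + p) ≤ (1 - p) * (1 + 4 * p) := by nlinarith
    have hpos : 0 ≤ κ * (m + φ) * (A2 + B2) := by positivity
    have h3 : (1 - p) * quad S w w ≤
        (1 - p) * ((1 + 4 * p) * (κ * (m + φ)) * (A2 + B2)) := by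
      refine hE.trans ?_
      nlinarith [mul_le_mul_of_nonneg_right hc hpos]
    exact le_of_mul_le_mul_left h3 (by linarith)

theorem Gam_nonneg (φ κ K : ℝ) (hK : 0 ≤ K) : 0 ≤ Gam φ κ K :=
  le_trans (by positivity) (le_max_right _ _)

/-- The role of the first entry of `Γ`: half of the form on `V` pays for the damping by `K`. -/
theorem one_sub_mul_add_le {G δ s r : ℝ} (hG : 0 < G) (hG1 : G ≤ 1) (hK : 0 ≤ K)
    (hG2 : 2 * K ≤ G * (δ * κ)) (hc : G * r ^ 2 ≤ K * s ^ 2) :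
    (1 - G) * (K * s ^ 2 + r ^ 2) ≤ δ * κ * s ^ 2 / 2 := by
  refine le_of_mul_le_mul_left ?_ hG
  have h1 : 0 ≤ G ^ 2 * (K * s ^ 2) := by positivity
  calc G * ((1 - G) * (K * s ^ 2 + r ^ 2)) = (1 - G) * (G * (K * s ^ 2) + G * r ^ 2) := by ring
    _ ≤ (1 - G) * (G * (K * s ^ 2) + K * s ^ 2) := by
        have : 0 ≤ 1 - G := by linarith
        gcongr
    _ = K * s ^ 2 - G ^ 2 * (K * s ^ 2) := by ring
    _ ≤ K * s ^ 2 := by linarith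
    _ = 2 * K * (s ^ 2 / 2) := by ring
    _ ≤ G * (δ * κ) * (s ^ 2 / 2) := by gcongr
    _ = _ := by ring

/-- The role of the second entry of `Γ`: the noise cross term is at most a quarter of the form on
`V`. -/
theorem four_mul_mul_le {G δ s r : ℝ} (hG : 0 < G) (hδ : 0 ≤ δ) (hs : 0 ≤ s)
    (hG3 : 16 * K * φ ^ 2 ≤ G * δ ^ 2) (hc : G * r ^ 2 ≤ K * s ^ 2) :
    4 * (φ * r) ≤ δ * s := by
  refine le_of_sq_le_sq ?_ (by positivity)
  refine le_of_mul_le_mul_left ?_ hG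
  calc G * (4 * (φ * r)) ^ 2 = 16 * φ ^ 2 * (G * r ^ 2) := by ring
    _ ≤ 16 * φ ^ 2 * (K * s ^ 2) := by gcongr
    _ = 16 * K * φ ^ 2 * s ^ 2 := by ring
    _ ≤ G * δ ^ 2 * s ^ 2 := by gcongr
    _ = _ := by ring

/-- With `s = ‖a‖ / √K` and `r = ‖b‖`, the input has squared norm `K s² + r²` and its image `s² +
r²`. The cases are `K s² ≤ Γ r²`, where `S ≥ 1` is enough, and the opposite, where the mass in `V`
dominates. -/
theorem le_quad (h : NoisyCov p φ κ S E N) (hK : 0 < K) (hp : 4 * p ≤ 1) (hφ2 : φ ≠ 1 / 2)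
    {a b : EuclideanSpace ℝ (Fin d)}
    (ha : a ∈ topSpace κ (E + N)) (hb : b ∈ (topSpace κ (E + N))ᗮ) :
    (1 - 4 * p) ^ 2 * (1 - Gam φ κ K) * (‖a‖ ^ 2 + ‖b‖ ^ 2) ≤
      quad S ((1 / √K) • a + b) ((1 / √K) • a + b) := by
  have hκ := h.κ_pos
  have hp0 := h.p_nonneg
  have hφ := h.φ_nonneg
  have hM : (E + N).IsHermitian := h.E_herm.add h.N_herm
  set k := 1 / √K with hk
  have hk2 : k ^ 2 = 1 / K := by rw [hk, div_pow, Real.sq_sqrt hK.le, one_pow]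
  have hk0 : 0 < k := by positivity
  set w := k • a + b with hw
  set s := k * ‖a‖ with hs
  have hs0 : 0 ≤ s := by positivity
  set r := ‖b‖ with hr
  have hr0 : 0 ≤ r := norm_nonneg b
  have hA : ‖a‖ ^ 2 = K * s ^ 2 := by rw [hs, mul_pow, hk2]; field_simp
  have hwn : ‖w‖ ^ 2 = s ^ 2 + r ^ 2 := by
    rw [hw, norm_smul_add_sq (hb a ha), hs, mul_pow]
  rw [hA]
  set G := Gam φ κ K with hG
  have hG0 : 0 ≤ G := Gam_nonneg _ _ _ hK.le
  have hSw := h.one_le w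
  rw [hwn] at hSw
  have hq1 : (1 - 4 * p) ^ 2 ≤ 1 := by nlinarith
  -- The factor `(1 - 4p)²` is at most `1`, but `1 - G` may be negative, so it is dropped on the
  -- side of `quad S w w ≥ 0`.
  have hred : (1 - G) * (K * s ^ 2 + r ^ 2) ≤ quad S w w →
      (1 - 4 * p) ^ 2 * (1 - G) * (K * s ^ 2 + r ^ 2) ≤ quad S w w := by
    intro hh
    have h0 : 0 ≤ quad S w w := le_trans (by positivity) hSw
    rw [mul_assoc]
    calc (1 - 4 * p) ^ 2 * ((1 - G) * (K * s ^ 2 + r ^ 2)) ≤ (1 - 4 * p) ^ 2 * quad S w w := by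
          gcongr
      _ ≤ 1 * quad S w w := by gcongr
      _ = _ := one_mul _
  rcases le_or_gt K 1 with hK1 | hK1
  · refine hred (le_trans ?_ hSw)
    have : K * s ^ 2 ≤ 1 * s ^ 2 := by gcongr
    nlinarith [mul_nonneg hG0 (by positivity : 0 ≤ K * s ^ 2 + r ^ 2)]
  rcases le_or_gt 1 G with hG1 | hG1
  · refine hred (le_trans ?_ hSw)
    nlinarith [mul_nonneg (sub_nonneg.mpr hG1) (by positivity : 0 ≤ K * s ^ 2 + r ^ 2),
      sq_nonneg s, sq_nonneg r]
  -- For `φ > 1/2` the second entry of `Γ` exceeds `16`. At `φ = 1/2` division by zero would make `Γ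
  -- = 0`, hence the hypothesis `hφ2`.
  have hφ3 : φ < 1 / 2 := by
    by_contra! hcon
    have hlt : 1 / 2 < φ := lt_of_le_of_ne hcon (Ne.symm hφ2)
    have h1 : 16 * K * φ ^ 2 / (1 / 2 - φ) ^ 2 ≤ G := le_max_right _ _
    have h2 : 0 < (1 / 2 - φ) ^ 2 := by nlinarith [mul_pos (sub_pos.mpr hlt) (sub_pos.mpr hlt)]
    rw [div_le_iff₀ h2] at h1
    nlinarith [mul_pos (sub_pos.mpr hK1) (by positivity : 0 < φ ^ 2)]
  set δ := 1 / 2 - φ with hδ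
  have hδ0 : 0 < δ := by linarith
  have hG2 : 2 * K ≤ G * (δ * κ) := by
    have h1 : 2 * K / (δ * κ) ≤ G := le_max_left _ _
    rwa [div_le_iff₀ (by positivity)] at h1
  have hG3 : 16 * K * φ ^ 2 ≤ G * δ ^ 2 := by
    have h1 : 16 * K * φ ^ 2 / δ ^ 2 ≤ G := le_max_right _ _
    rwa [div_le_iff₀ (by positivity)] at h1
  have hGpos : 0 < G := by
    by_contra! hcon
    have : G = 0 := le_antisymm hcon hG0
    rw [this] at hG2
    linarith
  rcases le_or_gt (K * s ^ 2) (G * r ^ 2) with hc | hc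
  · refine hred (le_trans ?_ hSw)
    have h1 : (1 - G) * (K * s ^ 2 + r ^ 2) ≤ (1 - G) * (G * r ^ 2 + r ^ 2) := by
      gcongr
    have h2 : (1 - G) * (G * r ^ 2 + r ^ 2) = r ^ 2 - (G * r) ^ 2 := by ring
    linarith [sq_nonneg (G * r), sq_nonneg s]
  · have hE : (1 - G) * (K * s ^ 2 + r ^ 2) ≤ quad E w w := by
      have e1 : quad E w w = k ^ 2 * quad E a a + 2 * k * quad E a b + quad E b b := by
        rw [hw, quad_smul_add h.E_herm]
      have e2 : k ^ 2 * ((κ / 2 - κ * φ / 2) * ‖a‖ ^ 2) ≤ k ^ 2 * quad E a a := by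
        have f1 := le_quad_of_mem_topSpace hM ha
        have f2 := (le_abs_self _).trans (h.abs_quad_noise_le a a)
        rw [← sq] at f2
        rw [quad_add] at f1
        gcongr
        linarith
      -- `E + N` has no cross term, so that of `E` is pure noise.
      have e3 : quad E a b = -quad N a b := by
        have := quad_eq_zero_of_mem_topSpace hM ha hb
        rw [quad_add] at this
        linarith
      have e4 : 2 * k * quad N a b ≤ κ * φ * (s * r) := by
        have f2 := (le_abs_self _).trans (h.abs_quad_noise_le a b)
        calc 2 * k * quad N a b ≤ 2 * k * (κ * φ / 2 * (‖a‖ * ‖b‖)) := by gcongr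
          _ = _ := by rw [hs, hr]; ring
      have e5 : k ^ 2 * ((κ / 2 - κ * φ / 2) * ‖a‖ ^ 2) = (κ / 2 - κ * φ / 2) * s ^ 2 := by
        rw [hs]; ring
      have e6 : 4 * (φ * r) ≤ δ * s := four_mul_mul_le hGpos hδ0.le hs0 hG3 hc.le
      have e7 : κ * φ * (s * r) ≤ κ * δ * s ^ 2 / 4 := by
        have := mul_le_mul_of_nonneg_left e6 (mul_nonneg hκ.le hs0)
        linarith
      have e8 : δ * κ * s ^ 2 ≤ (κ / 2 - κ * φ / 2) * s ^ 2 := by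
        gcongr
        have h1 := mul_nonneg hκ.le hφ
        have h2 : δ * κ = κ / 2 - κ * φ := by rw [hδ]; ring
        linarith
      have e9 : (1 - G) * (K * s ^ 2 + r ^ 2) ≤ δ * κ * s ^ 2 / 2 :=
        one_sub_mul_add_le hGpos hG1.le hK.le hG2 hc.le
      have e10 := h.E_nonneg b
      have e11 : 0 ≤ δ * κ * s ^ 2 := by positivity
      rw [e1, e3]
      linarith
    have h2 : (1 - 4 * p) ^ 2 * (1 + p) ≤ 1 := by nlinarith [mul_nonneg hp0 hp0]
    rw [mul_assoc]
    calc (1 - 4 * p) ^ 2 * ((1 - G) * (K * s ^ 2 + r ^ 2)) ≤ (1 - 4 * p) ^ 2 * quad E w w := by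
          gcongr
      _ ≤ (1 - 4 * p) ^ 2 * ((1 + p) * quad S w w) := by gcongr; exact h.E_le w
      _ = (1 - 4 * p) ^ 2 * (1 + p) * quad S w w := by ring
      _ ≤ 1 * quad S w w := by
          gcongr
          exact le_trans (by positivity) hSw
      _ = _ := one_mul _

theorem norm_starProjection_sq (V : Submodule ℝ (EuclideanSpace ℝ (Fin d)))
    (x : EuclideanSpace ℝ (Fin d)) :
    ‖V.starProjection x‖ ^ 2 + ‖Vᗮ.starProjection x‖ ^ 2 = ‖x‖ ^ 2 :=
  (Submodule.norm_sq_eq_add_norm_sq_starProjection x V).symm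

theorem isHermitian_mul_mul (h : NoisyCov p φ κ S E N) {A : Matrix (Fin d) (Fin d) ℝ}
    (hA : A.IsHermitian) : (A * S * A).IsHermitian := by
  have := Matrix.isHermitian_conjTranspose_mul_mul A h.S_herm
  rwa [hA.eq] at this

theorem smul_one_isHermitian (c : ℝ) : (c • (1 : Matrix (Fin d) (Fin d) ℝ)).IsHermitian :=
  Matrix.isHermitian_one.smul (IsSelfAdjoint.all _)

theorem precond_mul_mul_le (h : NoisyCov p φ κ S E N) (hK : 0 < K) :
    precond K (topSpace κ (E + N)) * S * precond K (topSpace κ (E + N)) ≤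
      ((1 + 4 * p) * (κ * (max (1 / K) (1 / 2) + φ))) • 1 := by
  have hA := precond_isHermitian K (topSpace κ (E + N))
  refine le_of_quad_le (h.isHermitian_mul_mul hA) (smul_one_isHermitian _) fun x => ?_
  rw [quad_mul_mul hA, quad_smul_one, toEuclideanCLM_precond,
    ← norm_starProjection_sq (topSpace κ (E + N)) x]
  exact h.quad_le hK (Submodule.starProjection_apply_mem _ _)
    (Submodule.starProjection_apply_mem _ _)

theorem le_precond_mul_mul (h : NoisyCov p φ κ S E N) (hK : 0 < K) (hp : 4 * p ≤ 1)
    (hφ2 : φ ≠ 1 / 2) :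
    ((1 - 4 * p) ^ 2 * (1 - Gam φ κ K)) • 1 ≤
      precond K (topSpace κ (E + N)) * S * precond K (topSpace κ (E + N)) := by
  have hA := precond_isHermitian K (topSpace κ (E + N))
  refine le_of_quad_le (smul_one_isHermitian _) (h.isHermitian_mul_mul hA) fun x => ?_
  rw [quad_mul_mul hA, quad_smul_one, toEuclideanCLM_precond,
    ← norm_starProjection_sq (topSpace κ (E + N)) x]
  exact h.le_quad hK hp hφ2 (Submodule.starProjection_apply_mem _ _)
    (Submodule.starProjection_apply_mem _ _)

theorem smul_mul_smul_eq (A S : Matrix (Fin d) (Fin d) ℝ) :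
    ((1.1 : ℝ) • A) * S * ((1.1 : ℝ) • A) = (1.21 : ℝ) • (A * S * A) := by
  rw [smul_mul_assoc, smul_mul_assoc, mul_smul_comm, smul_smul]
  norm_num

/-- Numerically, `1.21 · 0.99² · 0.986 > 1` below and `1.21 · 1.01 · 0.51 < 0.7` above. -/
theorem improvement (h : NoisyCov p φ κ S E N) (hκ : 1000 < κ) (hp : 4 * p ≤ 1 / 100)
    (hφ2 : φ ≤ 1 / 100) {A : Matrix (Fin d) (Fin d) ℝ}
    (hA : A = precond 2 (topSpace κ (E + N))) :
    1 ≤ ((1.1 : ℝ) • A) * S * ((1.1 : ℝ) • A) ∧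
      ((1.1 : ℝ) • A) * S * ((1.1 : ℝ) • A) ≤ (7 / 10 * κ) • 1 := by
  have hp0 := h.p_nonneg
  have hφ := h.φ_nonneg
  have h1 := h.precond_mul_mul_le (K := 2) two_pos
  have h2 := h.le_precond_mul_mul (K := 2) two_pos (by linarith) (by linarith)
  have hA' : A.IsHermitian := by rw [hA]; exact precond_isHermitian _ _
  rw [← hA] at h1 h2
  have hherm := h.isHermitian_mul_mul hA'
  have hq : ∀ x, quad ((1.21 : ℝ) • (A * S * A)) x x = 1.21 * quad (A * S * A) x x := fun x =>
    quad_smul _ _ _ _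
  have hherm' : ((1.21 : ℝ) • (A * S * A)).IsHermitian := hherm.smul (IsSelfAdjoint.all _)
  rw [smul_mul_smul_eq]
  generalize A * S * A = B at *
  constructor
  · refine le_of_quad_le Matrix.isHermitian_one hherm' fun x => ?_
    have h3 := quad_le_of_le h2 x
    rw [quad_smul_one] at h3
    have h4 := quad_smul_one 1 x
    rw [one_smul] at h4
    rw [hq, h4]
    -- The two entries are at most `4 / (0.49 · 1000)` and `32 · 10⁻⁴ / 0.49²`.
    have hG : Gam φ κ 2 ≤ 14 / 1000 := by
      refine max_le ?_ ?_
      · rw [div_le_iff₀ (by nlinarith)]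
        nlinarith
      · rw [div_le_iff₀ (by nlinarith)]
        nlinarith
    have hc : 1 ≤ 1.21 * ((1 - 4 * p) ^ 2 * (1 - Gam φ κ 2)) := by
      have e1 : (0.99 : ℝ) ^ 2 ≤ (1 - 4 * p) ^ 2 := pow_le_pow_left₀ (by norm_num) (by linarith) 2
      have e2 : (0.986 : ℝ) ≤ 1 - Gam φ κ 2 := by linarith
      have := mul_le_mul e1 e2 (by norm_num) (by positivity)
      nlinarith
    nlinarith [mul_le_mul_of_nonneg_right hc (sq_nonneg ‖x‖)]
  · refine le_of_quad_le hherm' (smul_one_isHermitian _) fun x => ?_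
    have h3 := quad_le_of_le h1 x
    rw [quad_smul_one] at h3
    rw [hq, quad_smul_one]
    have hmax : max (1 / 2 : ℝ) (1 / 2) = 1 / 2 := max_self _
    rw [hmax] at h3
    have hc : 1.21 * ((1 + 4 * p) * (κ * (1 / 2 + φ))) ≤ 7 / 10 * κ := by
      have e1 : (1 + 4 * p) * (1 / 2 + φ) ≤ 1.01 * 0.51 := by
        gcongr <;> linarith
      nlinarith
    nlinarith [mul_le_mul_of_nonneg_right hc (sq_nonneg ‖x‖)]

end NoisyCov

end Deterministic

/-! ### Regular datasets -/

section Regularity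

variable {d n : ℕ}

theorem quad_vecMulVec (u x : EuclideanSpace ℝ (Fin d)) :
    quad (Matrix.vecMulVec u.ofLp u.ofLp) x x = inner ℝ u x ^ 2 := by
  have h1 : inner ℝ u x = ∑ i, u i * x i := by simp [PiLp.inner_apply, mul_comm]
  rw [quad, Matrix.inner_toEuclideanCLM, h1, sq, Finset.sum_mul_sum]
  simp only [dotProduct, Matrix.mulVec, Matrix.vecMulVec_apply, Finset.mul_sum]
  exact Finset.sum_congr rfl fun i _ => Finset.sum_congr rfl fun j _ => by ring

theorem quad_empCov (X : Fin n → EuclideanSpace ℝ (Fin d)) (x : EuclideanSpace ℝ (Fin d)) :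
    quad (empCov X) x x = (n : ℝ)⁻¹ * ∑ i, inner ℝ (X i) x ^ 2 := by
  rw [empCov, quad_smul]
  congr 1
  simp only [← quad_vecMulVec]
  simp [quad, inner_sum]

theorem empCov_isHermitian (X : Fin n → EuclideanSpace ℝ (Fin d)) :
    (empCov X).IsHermitian := by
  ext i j
  simp [empCov, Matrix.sum_apply, Matrix.vecMulVec_apply, mul_comm]

theorem isHermitian_of_one_le {S : Matrix (Fin d) (Fin d) ℝ} (hS : 1 ≤ S) : S.IsHermitian := by
  have := (Matrix.le_iff.mp hS).1.add Matrix.isHermitian_one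
  rwa [sub_add_cancel] at this

theorem posDef_of_one_le {S : Matrix (Fin d) (Fin d) ℝ} (hS : 1 ≤ S) : S.PosDef := by
  have := Matrix.PosDef.one.add_posSemidef (Matrix.le_iff.mp hS)
  rwa [add_sub_cancel] at this

theorem sqrt_mul_sqrt_of_one_le {S : Matrix (Fin d) (Fin d) ℝ} (hS : 1 ≤ S) :
    CFC.sqrt S * CFC.sqrt S = S :=
  CFC.sqrt_mul_sqrt_self S (posDef_of_one_le hS).posSemidef.nonneg

theorem sqrt_isHermitian (S : Matrix (Fin d) (Fin d) ℝ) : (CFC.sqrt S).IsHermitian :=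
  (Matrix.nonneg_iff_posSemidef.mp (CFC.sqrt_nonneg S)).1

theorem toEuclideanCLM_sqrt_whiten {S : Matrix (Fin d) (Fin d) ℝ} (hS : 1 ≤ S)
    (X : Fin n → EuclideanSpace ℝ (Fin d)) (i : Fin n) :
    Matrix.toEuclideanCLM (𝕜 := ℝ) (CFC.sqrt S) (whiten S X i) = X i := by
  have hdet : IsUnit (CFC.sqrt S).det := by
    have h1 := congrArg Matrix.det (sqrt_mul_sqrt_of_one_le hS)
    rw [Matrix.det_mul] at h1
    rw [isUnit_iff_ne_zero]
    intro h0
    rw [h0, zero_mul] at h1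
    exact (posDef_of_one_le hS).det_pos.ne h1
  rw [whiten, Matrix.toEuclideanCLM_toLp, Matrix.mulVec_mulVec, Matrix.mul_nonsing_inv _ hdet,
    Matrix.one_mulVec]

theorem quad_sqrt {S : Matrix (Fin d) (Fin d) ℝ} (hS : 1 ≤ S) (x : EuclideanSpace ℝ (Fin d)) :
    ‖Matrix.toEuclideanCLM (𝕜 := ℝ) (CFC.sqrt S) x‖ ^ 2 = quad S x x := by
  have h := quad_mul_mul (sqrt_isHermitian S) 1 x x
  rw [mul_one, sqrt_mul_sqrt_of_one_le hS] at h
  rw [h, ← real_inner_self_eq_norm_sq, quad, map_one]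
  rfl

/-- Since `X i = S^{1/2} Y i`, one has `⟪Y i, S^{1/2} x⟫ = ⟪X i, x⟫`. This converts bounds on the
whitened covariance into bounds relative to `S`. -/
theorem quad_empCov_whiten {S : Matrix (Fin d) (Fin d) ℝ} (hS : 1 ≤ S)
    (X : Fin n → EuclideanSpace ℝ (Fin d)) (x : EuclideanSpace ℝ (Fin d)) :
    quad (empCov (whiten S X)) (Matrix.toEuclideanCLM (𝕜 := ℝ) (CFC.sqrt S) x)
      (Matrix.toEuclideanCLM (𝕜 := ℝ) (CFC.sqrt S) x) = quad (empCov X) x x := by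
  simp only [quad_empCov]
  congr 1
  refine Finset.sum_congr rfl fun i _ => ?_
  rw [← inner_toEuclideanCLM_comm (sqrt_isHermitian S), toEuclideanCLM_sqrt_whiten hS]

theorem norm_sq_le_quad {S : Matrix (Fin d) (Fin d) ℝ} (hS : 1 ≤ S)
    (x : EuclideanSpace ℝ (Fin d)) : ‖x‖ ^ 2 ≤ quad S x x := by
  have h1 := quad_le_of_le hS x
  have h2 := quad_smul_one 1 x
  rw [one_smul, one_mul] at h2
  linarith

/-- No sample is discarded, because `‖X i‖²` is the form of `S ≤ κ` at the whitened sample. -/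
theorem Regular.truncCov_eq_empCov {c₁ c₂ c₃ cS β κ : ℝ} {S : Matrix (Fin d) (Fin d) ℝ}
    {X : Fin n → EuclideanSpace ℝ (Fin d)} (h : Regular c₁ c₂ c₃ β S X) (hS : 1 ≤ S)
    (hSκ : S ≤ κ • 1) (hκ : 0 < κ) (hc : c₁ ≤ cS) (hlog : 0 ≤ Real.log (n / β)) :
    truncCov (threshold cS d n β κ) X = empCov X := by
  have hX : ∀ i, ‖X i‖ ^ 2 ≤ threshold cS d n β κ := by
    intro i
    have h1 := quad_le_of_le hSκ (whiten S X i)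
    rw [quad_smul_one, ← quad_sqrt hS, toEuclideanCLM_sqrt_whiten hS] at h1
    calc ‖X i‖ ^ 2 ≤ κ * ‖whiten S X i‖ ^ 2 := h1
      _ ≤ κ * (c₁ * (d * Real.log (n / β))) := by gcongr; exact h.norm_sq_le i
      _ ≤ κ * (cS * (d * Real.log (n / β))) := by gcongr
      _ = _ := by rw [threshold]; ring
  simp [truncCov, empCov, hX]

theorem Regular.noisyCov {c₁ c₂ c₃ β κ φ : ℝ} {S N : Matrix (Fin d) (Fin d) ℝ}
    {X : Fin n → EuclideanSpace ℝ (Fin d)} (h : Regular c₁ c₂ c₃ β S X) (hS : 1 ≤ S)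
    (hSκ : S ≤ κ • 1) (hκ : 0 < κ) (hc₂ : 0 ≤ c₂) (hφ : 0 ≤ φ) (hN : N.IsHermitian)
    (hNn : ‖Matrix.toEuclideanCLM (𝕜 := ℝ) N‖ ≤ κ * φ / 2) :
    NoisyCov (c₂ * √((d + Real.log (1 / β)) / n)) φ κ S (empCov X) N where
  p_nonneg := by positivity
  φ_nonneg := hφ
  κ_pos := hκ
  S_herm := isHermitian_of_one_le hS
  E_herm := empCov_isHermitian X
  N_herm := hN
  one_le := norm_sq_le_quad hS
  le_κ x := by
    rw [← quad_smul_one]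
    exact quad_le_of_le hSκ x
  E_nonneg x := by
    rw [quad_empCov]
    positivity
  le_E x := by
    rw [← quad_empCov_whiten hS, ← quad_sqrt hS, ← quad_smul_one]
    exact quad_le_of_le h.le_empCov _
  E_le x := by
    rw [← quad_empCov_whiten hS, ← quad_sqrt hS, ← quad_smul_one]
    exact quad_le_of_le h.empCov_le _
  norm_N := hNn

/-- The cone is the fixed-point set of the continuous map `psdProj`. -/
theorem isClosed_posSemidef : IsClosed {P : Matrix (Fin d) (Fin d) ℝ | P.PosSemidef} := by
  have : {P : Matrix (Fin d) (Fin d) ℝ | P.PosSemidef} = {P | psdProj P = P} := by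
    ext P
    refine ⟨fun h => psdProj_of_posSemidef h, fun h => ?_⟩
    have h : psdProj P = P := h
    rw [Set.mem_ofPred_eq, ← h]
    exact psdProj_posSemidef P
  rw [this]
  exact isClosed_eq continuous_psdProj continuous_id

theorem continuous_whiten (S : Matrix (Fin d) (Fin d) ℝ) :
    Continuous (whiten S : (Fin n → EuclideanSpace ℝ (Fin d)) → _) := by
  refine continuous_pi fun i => ?_
  exact (Matrix.toEuclideanCLM (𝕜 := ℝ) (CFC.sqrt S)⁻¹).continuous.comp (continuous_apply i)

theorem continuous_empCov :
    Continuous (empCov : (Fin n → EuclideanSpace ℝ (Fin d)) → _) := by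
  refine continuous_pi fun i => continuous_pi fun j => ?_
  simp only [empCov, Matrix.smul_apply, Matrix.sum_apply, Matrix.vecMulVec_apply]
  fun_prop

theorem continuous_frob : Continuous (frob : Matrix (Fin d) (Fin d) ℝ → ℝ) := by
  unfold frob
  refine Real.continuous_sqrt.comp (continuous_finsetSum _ fun i _ =>
    continuous_finsetSum _ fun j _ => ?_)
  exact ((continuous_apply j).comp (continuous_apply i)).pow 2

theorem isClosed_regular (c₁ c₂ c₃ β : ℝ) (S : Matrix (Fin d) (Fin d) ℝ) :
    IsClosed {X : Fin n → EuclideanSpace ℝ (Fin d) | Regular c₁ c₂ c₃ β S X} := by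
  have hw := continuous_whiten (n := n) S
  have he := continuous_empCov.comp hw
  have h1 : IsClosed {X : Fin n → EuclideanSpace ℝ (Fin d) |
      ∀ i, ‖whiten S X i‖ ^ 2 ≤ c₁ * (d * Real.log (n / β))} := by
    simp only [Set.ofPred_forall]
    exact isClosed_iInter fun i => isClosed_le
      ((((continuous_apply i).comp hw).norm).pow 2) continuous_const
  have h2 := isClosed_posSemidef.preimage
    (he.sub (continuous_const (y := (1 - c₂ * √((d + Real.log (1 / β)) / n)) • 1)))
  have h3 := isClosed_posSemidef.preimage
    ((continuous_const (y := (1 + c₂ * √((d + Real.log (1 / β)) / n)) • 1)).sub he)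
  have h4 := isClosed_le (continuous_frob.comp ((continuous_const (y := 1)).sub he))
    (continuous_const (y := c₃ * √(((d : ℝ) ^ 2 + Real.log (1 / β)) / n)))
  convert ((h1.inter h2).inter h3).inter h4 using 1
  ext X
  exact ⟨fun h => ⟨⟨⟨h.1, h.2⟩, h.3⟩, h.4⟩, fun h => ⟨h.1.1.1, h.1.1.2, h.1.2, h.2⟩⟩

end Regularity

/-! ### Sample size -/

section SampleSize

variable {d n p : ℕ} {ρ β C D : ℝ}

theorem log_le_log_two_add_div (hd : 1 ≤ d) (hρ : 0 < ρ) (hβ : 0 < β) :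
    Real.log (1 / β) ≤ Real.log (2 + d / (min ρ 1 * β)) := by
  have hd' : (1 : ℝ) ≤ d := by exact_mod_cast hd
  have hm : 0 < min ρ 1 := lt_min hρ one_pos
  refine Real.log_le_log (by positivity) ?_
  have h1 : 1 / β ≤ d / (min ρ 1 * β) := by
    rw [div_le_div_iff₀ hβ (by positivity), one_mul]
    have : min ρ 1 ≤ d := (min_le_right _ _).trans hd'
    gcongr
  linarith

theorem log_rpow_div_sqrt_le (hd : 1 ≤ d) (hρ : 0 < ρ) (hβ : 0 < β) (hβ1 : β ≤ 1) :
    Real.log ((d : ℝ) ^ (3 / 2 : ℝ) / √ρ) ≤ 3 / 2 * Real.log (2 + d / (min ρ 1 * β)) := by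
  have hd' : (1 : ℝ) ≤ d := by exact_mod_cast hd
  have hd0 : (0 : ℝ) < d := by linarith
  set m := min ρ 1 with hmdef
  have hm : 0 < m := lt_min hρ one_pos
  have h1 : Real.log (d / m) ≤ Real.log (2 + d / (m * β)) := by
    refine Real.log_le_log (by positivity) ?_
    have : d / m ≤ d / (m * β) := by
      gcongr
      nlinarith
    linarith
  rw [Real.log_div hd0.ne' hm.ne'] at h1
  rw [Real.log_div (by positivity) (by positivity), Real.log_rpow hd0, Real.log_sqrt hρ.le]
  have h2 : Real.log m ≤ Real.log ρ := Real.log_le_log hm (min_le_left _ _)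
  have h3 : Real.log m ≤ 0 := Real.log_nonpos hm.le (min_le_right _ _)
  linarith

/-- With `B = d^{3/2} / √ρ`, `s = √(n / B)` and `Λ` the logarithm in the sample size, the hypothesis
says `DΛ ≤ s`. Both `log B` and `log (1/β)` are at most multiples of `Λ`, so `log (n/β) = O(s)` and
`log (1/β) ≤ s / D`, while `φ` has `s²` in the denominator. This is why the exponent `2` suffices.
-/
theorem phi_le_of_enoughSamples (hd : 1 ≤ d) (hn : 1 ≤ n) (hρ : 0 < ρ) (hβ : 0 < β)
    (hL : 1 ≤ Real.log (1 / β)) (hC : 0 ≤ C) (hD : 1 ≤ D)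
    (h : EnoughSamples (D ^ 2) 2 d n ρ β) : phi C d n ρ β ≤ 5 * C / D := by
  have hd' : (1 : ℝ) ≤ d := by exact_mod_cast hd
  have hn' : (1 : ℝ) ≤ n := by exact_mod_cast hn
  have hβ1 : β ≤ 1 := by
    by_contra! hcon
    have : Real.log (1 / β) ≤ 0 := Real.log_nonpos (by positivity) (by
      rw [div_le_one hβ]; exact hcon.le)
    linarith
  have hΛ := log_le_log_two_add_div hd hρ hβ
  have hlogB := log_rpow_div_sqrt_le hd hρ hβ hβ1
  have hsamp := h.1
  set L := Real.log (1 / β) with hLdef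
  set Λ := Real.log (2 + d / (min ρ 1 * β)) with hΛdef
  set B := (d : ℝ) ^ (3 / 2 : ℝ) / √ρ with hB
  have hB0 : 0 < B := by positivity
  set s := √(n / B) with hs
  have hs2 : s ^ 2 = n / B := Real.sq_sqrt (by positivity)
  have hs0 : 0 < s := Real.sqrt_pos.mpr (by positivity)
  have hDs : D * Λ ≤ s := by
    refine Real.le_sqrt_of_sq_le ?_
    rw [le_div_iff₀ hB0]
    calc (D * Λ) ^ 2 * B = D ^ 2 * ((d : ℝ) ^ (3 / 2 : ℝ) * Λ ^ 2 / √ρ) := by rw [hB]; ring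
      _ ≤ (n : ℝ) := hsamp
  have hlogn : Real.log (n / β) ≤ 5 * s := by
    have e1 : Real.log (n / β) = Real.log B + Real.log (s ^ 2) + L := by
      rw [hs2, ← Real.log_mul hB0.ne' (by positivity), hLdef,
        ← Real.log_mul (by positivity) (by positivity)]
      congr 1
      field_simp
    have e2 : Real.log (s ^ 2) ≤ 2 * s := by
      rw [Real.log_pow]
      push_cast
      linarith [Real.log_le_sub_one_of_pos hs0]
    have e3 : Λ ≤ s := by nlinarith
    rw [e1]
    linarith
  have hphi : phi C d n ρ β = C * (Real.log (n / β) * L / s ^ 2) := by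
    rw [phi, ← hLdef, hs2, hB]
    field_simp
  have hLs : L ≤ s / D := by
    rw [le_div_iff₀ (by linarith)]
    nlinarith
  rw [hphi]
  calc C * (Real.log (n / β) * L / s ^ 2) ≤ C * (5 * s * (s / D) / s ^ 2) := by gcongr
    _ = 5 * C / D := by field_simp

/-- For `ρ ≤ 1`, `(d + L) / 2 ≤ d L ≤ d^{3/2} Λ²`, and dividing by `√ρ` only helps. For `ρ > 1` that
division loses, and the extra sample requirement takes over. -/
theorem psi_le_of_enoughSamples (hd : 1 ≤ d) (hn : 1 ≤ n) (hρ : 0 < ρ) (hβ : 0 < β)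
    (hL : 1 ≤ Real.log (1 / β)) (hC : 0 ≤ C) (hD : 0 < D)
    (h : EnoughSamples (D ^ 2) 2 d n ρ β) : psi C d n β ≤ 2 * C / D := by
  have hd' : (1 : ℝ) ≤ d := by exact_mod_cast hd
  have hn' : (1 : ℝ) ≤ n := by exact_mod_cast hn
  have hΛ := log_le_log_two_add_div hd hρ hβ
  have hsamp := h.1
  set L := Real.log (1 / β) with hLdef
  set Λ := Real.log (2 + d / (min ρ 1 * β)) with hΛdef
  have key : D ^ 2 * (d + L) ≤ 4 * n := by
    rcases lt_or_ge 1 ρ with h1 | h1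
    · have := h.2 h1
      linarith
    · have hd32 : (d : ℝ) ≤ (d : ℝ) ^ (3 / 2 : ℝ) := by
        conv_lhs => rw [← Real.rpow_one (d : ℝ)]
        exact Real.rpow_le_rpow_of_exponent_le hd' (by norm_num)
      have hΛ2 : L ≤ Λ ^ 2 := by nlinarith
      have e1 : (d + L) / 2 ≤ (d : ℝ) ^ (3 / 2 : ℝ) * Λ ^ 2 := by
        have f1 : d * L ≤ (d : ℝ) ^ (3 / 2 : ℝ) * Λ ^ 2 := by gcongr
        nlinarith
      have e2 : (d : ℝ) ^ (3 / 2 : ℝ) * Λ ^ 2 ≤ (d : ℝ) ^ (3 / 2 : ℝ) * Λ ^ 2 / √ρ := by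
        rw [le_div_iff₀ (Real.sqrt_pos.mpr hρ)]
        refine mul_le_of_le_one_right (by positivity) ?_
        exact Real.sqrt_le_one.mpr h1
      have e3 := mul_le_mul_of_nonneg_left (e1.trans e2) (sq_nonneg D)
      linarith
  have hsq : √((d + L) / n) ≤ 2 / D := by
    rw [Real.sqrt_le_left (by positivity), div_pow, div_le_div_iff₀ (by positivity) (by positivity)]
    linarith
  calc psi C d n β ≤ C * (2 / D) := by unfold psi; gcongr
    _ = _ := by ring

end SampleSize

/-! ### Accuracy -/

section Accuracy

variable {d n : ℕ}

/-- Explains the choice `Cφ = 40 cN`: the high-probability noise bound becomes exactly `κφ/2`. -/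
theorem half_kappa_mul_phi {cN ρ β κ : ℝ} :
    κ * phi (40 * cN) d n ρ β / 2 = 20 * (noiseScale cN d n ρ β κ * √d * Real.log (1 / β)) := by
  have h : (d : ℝ) ^ (3 / 2 : ℝ) = d * √d := by
    rw [show (3 / 2 : ℝ) = 1 + 1 / 2 by norm_num,
      Real.rpow_add_of_nonneg (Nat.cast_nonneg d) zero_le_one (by norm_num), Real.rpow_one,
      Real.sqrt_eq_rpow]
  rw [phi, noiseScale, h]
  ring

/-- With probability at least `1 - β`, the output of `WeakPPC` on a regular dataset is computed
from an accurate noisy covariance. -/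
theorem ofReal_le_weakPPC {c₁ c₂ c₃ cS cN ρ β κ K : ℝ} (hc₁ : 0 < c₁) (hc₂ : 0 < c₂)
    (hcS : c₁ ≤ cS) (hcN : √2 * cS ≤ cN) (hd : 1 ≤ d) (hn : 1 ≤ n) (hρ : 0 < ρ) (hβ : 0 < β)
    (hL : 1 ≤ Real.log (1 / β)) (hκ : 0 < κ) {S : Matrix (Fin d) (Fin d) ℝ} (hS : 1 ≤ S)
    (hSκ : S ≤ κ • 1) {X : Fin n → EuclideanSpace ℝ (Fin d)} (hX : Regular c₁ c₂ c₃ β S X)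
    {good : Set (Submodule ℝ (EuclideanSpace ℝ (Fin d)) × Matrix (Fin d) (Fin d) ℝ)}
    (hgood : ∀ E N, NoisyCov (c₂ * √((d + Real.log (1 / β)) / n))
      (phi (40 * cN) d n ρ β) κ S E N → output κ K (E + N) ∈ good) :
    ENNReal.ofReal (1 - β) ≤ weakPPC cS cN ρ β κ K X good := by
  have hcN0 : 0 < cN := lt_of_lt_of_le (by have := hc₁.trans_le hcS; positivity) hcN
  have hn' : (1 : ℝ) ≤ n := by exact_mod_cast hn
  have hd' : (1 : ℝ) ≤ d := by exact_mod_cast hd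
  have hlog : 0 < Real.log (n / β) := by
    have : Real.log (1 / β) ≤ Real.log (n / β) :=
      Real.log_le_log (by positivity) (by gcongr)
    linarith
  have hσ : 0 < noiseScale cN d n ρ β κ := by unfold noiseScale; positivity
  have hφ : 0 ≤ phi (40 * cN) d n ρ β := by unfold phi; positivity
  have hmeas : Measurable fun g =>
      output κ K (psdProj (truncCov (threshold cS d n β κ) X + symMat g)) := by
    have h := (measurable_output_psdProj (d := d) hκ K).comp
      (measurable_psdProj_add_symMat (truncCov (threshold cS d n β κ) X))
    simpa only [Function.comp_def, output_psdProj_psdProj] using h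
  rw [weakPPC_eq_map _ _ _ _ hκ]
  set v := (noiseScale cN d n ρ β κ ^ 2).toNNReal with hv
  have hv' : (v : ℝ) = noiseScale cN d n ρ β κ ^ 2 := Real.coe_toNNReal _ (sq_nonneg _)
  have hv0 : v ≠ 0 := by
    intro h0
    rw [h0] at hv'
    have : 0 < noiseScale cN d n ρ β κ ^ 2 := by positivity
    simp at hv'
    linarith
  -- The preimage bounds the push-forward from below for arbitrary sets, so `good` need not be
  -- measurable.
  refine (ofReal_le_measure_norm_symMat_le hd hv0 hβ hL).trans
    ((measure_mono fun g hg => ?_).trans (Measure.le_map_apply hmeas.aemeasurable _))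
  have hg' : ‖Matrix.toEuclideanCLM (𝕜 := ℝ) (symMat g)‖ ≤
      20 * (√v * √d * Real.log (1 / β)) := hg
  rw [hv', Real.sqrt_sq hσ.le, ← half_kappa_mul_phi] at hg'
  have hcov := hX.noisyCov hS hSκ hκ hc₂.le hφ (symMat_isHermitian g) hg'
  rw [Set.mem_preimage, hX.truncCov_eq_empCov hS hSκ hκ hcS hlog.le]
  have hout : output κ K (psdProj (empCov X + symMat g)) = output κ K (empCov X + symMat g) := by
    rw [output, output, topSpace_psdProj hκ (hcov.E_herm.add hcov.N_herm)]
  rw [hout]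
  exact hgood _ _ hcov

end Accuracy

end PrivCov

/-! ### Choice of constants and assembly -/

theorem mainTheorem3 :
    -- privacy
    (∀ (cS cN : ℝ), 0 < cS → √2 * cS ≤ cN →
      ∀ (d n : ℕ) (ρ β κ K : ℝ), 0 < ρ → 0 < β → 0 < κ → 0 < K →
        IsZCDP ρ (fun X : Fin n → EuclideanSpace ℝ (Fin d) => weakPPC cS cN ρ β κ K X)) ∧
    -- accuracy; `K₀` is the appropriate constant, `p` the exponent of the polylogarithm
    (∃ (K₀ : ℝ) (p : ℕ), 0 < K₀ ∧
      ∀ (c₁ c₂ c₃ cS cN : ℝ), 0 < c₁ → 0 < c₂ → 0 < c₃ → c₁ ≤ cS → √2 * cS ≤ cN →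
        ∃ (Cφ Cψ Cβ Cn : ℝ), 0 < Cφ ∧ 0 < Cψ ∧ 0 < Cβ ∧ 0 < Cn ∧
          ∀ (d n : ℕ) (ρ β κ K : ℝ), 1 ≤ n → 0 < ρ → 0 < β → 0 < κ → 0 < K →
          ∀ (S : Matrix (Fin d) (Fin d) ℝ), 1 ≤ S → S ≤ κ • 1 →
            let φ := phi Cφ d n ρ β
            let ψ := psi Cψ d n β
            let good : Set (Submodule ℝ (EuclideanSpace ℝ (Fin d)) × Matrix (Fin d) (Fin d) ℝ) :=
              {o |
                -- upper bound on `A S A`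
                o.2 * S * o.2 ≤ ((1 + ψ) * (κ * (max (1 / K) (1 / 2) + φ))) • 1 ∧
                -- lower bound on `A S A`
                (ψ ≤ 1 → φ ≠ 1 / 2 →
                  ((1 - ψ) ^ 2 * (1 - Gam φ κ K)) • 1 ≤ o.2 * S * o.2) ∧
                -- the condition number improves by a constant factor
                (1000 < κ → K = K₀ → EnoughSamples Cn p d n ρ β →
                  1 ≤ ((1.1 : ℝ) • o.2) * S * ((1.1 : ℝ) • o.2) ∧
                  ((1.1 : ℝ) • o.2) * S * ((1.1 : ℝ) • o.2) ≤ (7 / 10 * κ) • 1)}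
            -- for every realization of the samples that satisfies the regularity conditions
            (∀ X : Fin n → EuclideanSpace ℝ (Fin d), Regular c₁ c₂ c₃ β S X →
              ENNReal.ofReal (1 - Cβ * β) ≤ weakPPC cS cN ρ β κ K X good) ∧
            -- hence for i.i.d. samples from `N(0, S)`, conditionally on these conditions
            (let P := Measure.pi fun _ : Fin n => multivariateGaussian 0 S
             ENNReal.ofReal (1 - Cβ * β) * P {X | Regular c₁ c₂ c₃ β S X} ≤
              ∫⁻ X in {X | Regular c₁ c₂ c₃ β S X}, weakPPC cS cN ρ β κ K X good ∂P)) := by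
  refine ⟨fun cS cN hcS hcN d n ρ β κ K hρ _ hκ _ => isZCDP_weakPPC hcS hcN β K hρ hκ,
    2, 2, two_pos, ?_⟩
  intro c₁ c₂ c₃ cS cN hc₁ hc₂ hc₃ hcS hcN
  have hcN0 : 0 < cN := lt_of_lt_of_le (by have := hc₁.trans_le hcS; positivity) hcN
  -- Large enough that the bounds `5 Cφ / D` on `φ` and `2 Cψ / D` on `ψ` are both at most `1/100`.
  set D : ℝ := 1 + 500 * (40 * cN) + 200 * (4 * c₂) with hD
  have hD1 : 1 ≤ D := by linarith
  refine ⟨40 * cN, 4 * c₂, 3, D ^ 2, by positivity, by positivity, by norm_num, by positivity, ?_⟩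
  intro d n ρ β κ K hn hρ hβ hκ hK S hS hSκ φ ψ good
  have main : ∀ X : Fin n → EuclideanSpace ℝ (Fin d), Regular c₁ c₂ c₃ β S X →
      ENNReal.ofReal (1 - 3 * β) ≤ weakPPC cS cN ρ β κ K X good := by
    intro X hX
    -- With `Cβ = 3` the claim is vacuous for `β ≥ 1/3`; below that, `log (1/β) ≥ 1` because `e <
    -- 3`.
    rcases le_or_gt (1 / 3) β with hβ3 | hβ3
    · rw [ENNReal.ofReal_of_nonpos (by linarith)]
      exact zero_le
    -- In dimension `0` all matrices coincide, so every output is good; the noise bound requires `d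
    -- ≥ 1`.
    rcases Nat.eq_zero_or_pos d with rfl | hd
    · have hg : good = Set.univ := Set.eq_univ_of_forall fun o =>
        ⟨le_of_eq (Subsingleton.elim _ _), fun _ _ => le_of_eq (Subsingleton.elim _ _),
          fun _ _ _ => ⟨le_of_eq (Subsingleton.elim _ _), le_of_eq (Subsingleton.elim _ _)⟩⟩
      have := isProbabilityMeasure_weakPPC cS cN ρ β hκ K X
      rw [hg, measure_univ, ← ENNReal.ofReal_one]
      exact ENNReal.ofReal_le_ofReal (by linarith)
    have hL : 1 ≤ Real.log (1 / β) := by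
      rw [Real.le_log_iff_exp_le (by positivity), le_div_iff₀ hβ]
      nlinarith [Real.exp_one_lt_d9]
    refine (ENNReal.ofReal_le_ofReal (by linarith)).trans
      (ofReal_le_weakPPC hc₁ hc₂ hcS hcN hd hn hρ hβ hL hκ hS hSκ hX fun E N hcov => ?_)
    have hψ : ψ = 4 * (c₂ * √((d + Real.log (1 / β)) / n)) := by
      simp only [ψ, psi]
      ring
    refine ⟨?_, fun hψ1 hφ2 => ?_, fun hκ' hK2 hsamp => ?_⟩
    · rw [hψ]
      exact hcov.precond_mul_mul_le hK
    · rw [hψ] at hψ1 ⊢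
      exact hcov.le_precond_mul_mul hK hψ1 hφ2
    · have h1 := phi_le_of_enoughSamples hd hn hρ hβ hL (by positivity : 0 ≤ 40 * cN) hD1 hsamp
      have h2 := psi_le_of_enoughSamples hd hn hρ hβ hL (by positivity : 0 ≤ 4 * c₂)
        (by linarith : 0 < D) hsamp
      have h3 : 5 * (40 * cN) / D ≤ 1 / 100 := by
        rw [div_le_iff₀ (by linarith)]
        linarith
      have h4 : 2 * (4 * c₂) / D ≤ 1 / 100 := by
        rw [div_le_iff₀ (by linarith)]
        linarith
      refine hcov.improvement hκ' ?_ (h1.trans h3) ?_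
      · rw [← hψ]
        exact h2.trans h4
      · rw [output, hK2]
  refine ⟨main, ?_⟩
  intro P
  have hmeas : MeasurableSet {X : Fin n → EuclideanSpace ℝ (Fin d) | Regular c₁ c₂ c₃ β S X} :=
    (isClosed_regular c₁ c₂ c₃ β S).measurableSet
  -- Integrate the pointwise bound over the regular datasets, a closed and hence measurable set.
  rw [← setLIntegral_const]
  exact setLIntegral_mono' hmeas fun X hX => main X hX
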